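/- Let $F$ be a finite field and let $V$ be an $F$-vector space of finite dimension $n\ge 1$. For an invertible linear map $x$ of $V$, write $V$, regarded as an $F[t]$-module on which $t$ acts as $x$, as a direct sum of cyclic modules $F[t]/(p_i^{e_i})$ with $p_i$ monic irreducible and $e_i\ge 1$; the $p_i^{e_i}$ are the elementary divisors of $x$. (1) Let $|F|=q$ be odd, let $Q$ be a non-singular quadratic form on $V$ (of any type $\epsilon\in\{+,-,\circ\}$), let $\mathrm{O}^{\epsilon}(n,q)$ be its isometry group and $\mathrm{SO}^{\epsilon}(n,q)$ the subgroup of elements of determinant $1$. For $x\in \mathrm{SO}^{\epsilon}(n,q)$, the $\mathrm{O}^{\epsilon}(n,q)$-conjugacy class of $x$ splits into exactly two $\mathrm{SO}^{\epsilon}(n,q)$-conjugacy classes if and only if $x$ has no elementary divisor $(t-1)^m$ or $(t+1)^m$ with $m$ odd. (2) Let $|F|=q^2$ with $q$ any prime power, let $\bar\lambda=\lambda^q$ for $\lambda \in F$, let $\beta$ be a non-degenerate hermitian form on $V$ (linear in the first variable, $\beta(u,v)=\overline{\beta(v,u)}$), let $\mathrm{U}(n,q)$ be its isometry group and $\mathrm{SU}(n,q)$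 the subgroup of elements of determinant $1$. For a monic $f\in F[t]$ of degree $d$ with constant coefficient $a_0\neq 0$ put $f^*(t)=\overline{a_0}^{\,-1}t^d\bar f(t^{-1})$, where $\bar f$ is $f$ with the bar applied to its coefficients. The generalized elementary divisors of $x\in\mathrm{SU}(n,q)$ are the $f^m$ such that either $f=f^*$ is monic irreducible and $f^m$ is an elementary divisor of $x$, or $f=gg^*$ with $g\neq g^*$ monic irreducible and $g^m$ is an elementary divisor of $x$. If $f_1^{m_1},\dots,f_k^{m_k}$ (the $f_i$ not necessarily distinct) are the generalized elementary divisors of $x\in\mathrm{SU}(n,q)$, then the $\mathrm{U}(n,q)$-conjugacy class of $x$ splits into exactly $\gcd(m_1,\dots,m_k,q+1)$ distinct $\mathrm{SU}(n,q)$-conjugacy classes. -/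

import Mathlib

open Polynomial
open scoped DirectSum

namespace ClassicalGroup

section Groups

variable {F V : Type*} [Field F] [AddCommGroup V] [Module F V]

/-- The group of isometries of a quadratic form `Q` on `V`, as a subgroup of `GL(V)`. -/
def orthogonalGroup (Q : QuadraticForm F V) : Subgroup (V ≃ₗ[F] V) where
  carrier := {g | ∀ v, Q (g v) = Q v}
  mul_mem' {a b} ha hb v := by
    rw [LinearEquiv.mul_apply, ha, hb]
  one_mem' _ := rfl
  inv_mem' {a} ha v := by
    rw [← ha (a⁻¹ v), ← LinearEquiv.mul_apply, mul_inv_cancel]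
    rfl

/-- The group of isometries of a form `β` on `V` that is linear in the first variable and
`σ`-semilinear in the second, as a subgroup of `GL(V)`. -/
def unitaryGroup {σ : F →+* F} (β : V →ₗ[F] V →ₛₗ[σ] F) : Subgroup (V ≃ₗ[F] V) where
  carrier := {g | ∀ u v, β (g u) (g v) = β u v}
  mul_mem' {a b} ha hb u v := by
    rw [LinearEquiv.mul_apply, LinearEquiv.mul_apply, ha, hb]
  one_mem' _ _ := rfl
  inv_mem' {a} ha u v := by
    rw [← ha (a⁻¹ u) (a⁻¹ v), ← LinearEquiv.mul_apply, ← LinearEquiv.mul_apply, mul_inv_cancel]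
    rfl

/-- The special group of a group `G` of linear automorphisms: the elements of `G` of
determinant `1`, as a subgroup of `G`. -/
noncomputable def special (G : Subgroup (V ≃ₗ[F] V)) : Subgroup G :=
  (LinearEquiv.det.comp G.subtype).ker

/-- A quadratic form is non-singular if its associated bilinear form
`(u, v) ↦ Q (u + v) - Q u - Q v` is non-degenerate. -/
def IsNonsingular (Q : QuadraticForm F V) : Prop :=
  Q.polarBilin.Nondegenerate

/-- `β` is hermitian with respect to `σ`: `β(u, v) = σ(β(v, u))`. -/
def IsHermitianForm {σ : F →+* F} (β : V →ₗ[F] V →ₛₗ[σ] F) : Prop :=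
  ∀ u v, β u v = σ (β v u)

end Groups

/-- The `S`-conjugacy classes contained in the `G`-conjugacy class of `x`. -/
def classesInside {G : Type*} [Group G] (S : Subgroup G) (x : S) : Set (ConjClasses S) :=
  {c | ∀ y : S, ConjClasses.mk y = c → IsConj (x : G) (y : G)}

section ElementaryDivisors

variable {F V : Type*} [Field F] [AddCommGroup V] [Module F V]

/-- `f₁^{m₁}, …, f_k^{m_k}` is the list of elementary divisors of `x`: the `f_i` are monic and
irreducible, the `m_i` are positive, and `V`, regarded as an `F[t]`-module on which `t` acts as
`x`, is the direct sum of cyclic modules `F[t] / (f_i^{m_i})`. -/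
structure HasElementaryDivisors (x : Module.End F V) {k : ℕ} (f : Fin k → F[X])
    (m : Fin k → ℕ) : Prop where
  monic : ∀ i, (f i).Monic
  irreducible : ∀ i, Irreducible (f i)
  pos : ∀ i, 0 < m i
  decomposition : Nonempty
    (Module.AEval' x ≃ₗ[F[X]] ⨁ i : Fin k, F[X] ⧸ Ideal.span {f i ^ m i})

/-- `f ^ m` (with `f` monic irreducible and `m` positive) occurs among the elementary divisors
of `x`. -/
def IsElementaryDivisor (x : Module.End F V) (f : F[X]) (m : ℕ) : Prop :=
  ∃ (k : ℕ) (g : Fin k → F[X]) (e : Fin k → ℕ),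
    HasElementaryDivisors x g e ∧ ∃ i, g i = f ∧ e i = m

/-- The dual polynomial `f^*(t) = σ(a₀)⁻¹ t^d (σ f)(t⁻¹)` of a polynomial `f` of degree `d` with
constant coefficient `a₀ ≠ 0`; here `σ f` is `f` with `σ` applied to the coefficients. -/
noncomputable def dualPoly (σ : F →+* F) (f : F[X]) : F[X] :=
  C (σ (f.coeff 0))⁻¹ * (f.map σ).reverse

/-- Monic irreducible `f = f^*` of degree `1`. -/
def Phi₁ (σ : F →+* F) : Set F[X] :=
  {f | f.Monic ∧ Irreducible f ∧ f.coeff 0 ≠ 0 ∧ dualPoly σ f = f ∧ f.natDegree = 1}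

/-- Monic irreducible `g ≠ g^*`; the set `Φ₂` consists of the products `g g^*` of these. -/
def NonSelfDual (σ : F →+* F) : Set F[X] :=
  {g | g.Monic ∧ Irreducible g ∧ g.coeff 0 ≠ 0 ∧ dualPoly σ g ≠ g}

/-- Monic irreducible `f = f^*` of degree greater than `1`. -/
def Phi₃ (σ : F →+* F) : Set F[X] :=
  {f | f.Monic ∧ Irreducible f ∧ f.coeff 0 ≠ 0 ∧ dualPoly σ f = f ∧ 1 < f.natDegree}

/-- `f ^ m` is a generalized elementary divisor of `x`: either `f ∈ Φ₁ ∪ Φ₃` and `f ^ m` is an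
elementary divisor of `x`, or `f = g g^* ∈ Φ₂` and `g ^ m` is an elementary divisor of `x`. -/
def IsGeneralizedElementaryDivisor (σ : F →+* F) (x : Module.End F V) (f : F[X]) (m : ℕ) : Prop :=
  (f ∈ Phi₁ σ ∪ Phi₃ σ ∧ IsElementaryDivisor x f m) ∨
    ∃ g ∈ NonSelfDual σ, f = g * dualPoly σ g ∧ IsElementaryDivisor x g m

end ElementaryDivisors

end ClassicalGroup

/-! Let `G` be the isometry group and `x` an element of its special subgroup, the kernel of `det`.
The number of special classes inside the `G`-class of `x` is the index of `det (C_G(x))` in `det G`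
(`ncard_classesInside_ker`), so both parts amount to computing the determinants of isometries `y`
commuting with `x`.

Upper bound. Over a finite field of characteristic `p` write the order of `x` as `p ^ a * k` with `p
∤ k`. Then `N = x ^ k - 1` is nilpotent and `X ^ k - 1` is squarefree, so the Jordan block sizes of
`N` occur among the exponents of the elementary divisors of `x`. The determinant of `y` is the
product of its determinants on the layers `ker N ⊓ range (N ^ i)`. If `d` divides every block size,
the layers coincide in runs of length `d`, so the product is a `d`-th power. Each layer determinant
`δ` satisfies `δ * σ δ = 1`, because `y` preserves the form induced on `range (N ^ i)`. This is
`exists_det_eq_pow`. In the orthogonal case `V` is split by a high odd power of the skew-adjoint map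
`x - x⁻¹`. On its range `y` preserves a non-degenerate alternating form and has determinant `1`; on
its kernel the layer argument with `N = x ^ 2 - 1` and `d = 2` gives the square of a sign
(`det_eq_one_of_no_odd_divisor`).

Lower bound. A block of size `m` for `f` gives cyclic submodules generated by `v` and `w` that are
paired perfectly by `β`, hence adjoint projections `e`, `e'` commuting with `x`. The map `B = 1 +
(p(x) - 1) e` has determinant equal to the `m`-th power of the norm of `p` modulo `f`
(`det_on_cyclic`). If `B'` is its adjoint, then `B * B'⁻¹` is an isometry; since norms of finite
fields are surjective, Hilbert 90 shows that its determinant can be `z ^ m` for any `z` of norm one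
(`exists_commuting_isometry_det`). In the orthogonal case with `m` odd, `B = 1 - 2e` itself is an
isometry of determinant `-1`.

In the unitary case `det G` is therefore the cyclic group of order `q + 1`, and the centralizer
yields its `d`-th powers for `d = gcd(m₁, …, m_k)`, a subgroup of index `gcd(d, q + 1)`. -/

namespace ClassicalGroup

/-! ### Determinants on invariant subspaces and Jordan layers -/

section DetOn

variable {F V : Type*} [Field F] [AddCommGroup V] [Module F V]

/-- The determinant of an endomorphism `y` on an invariant submodule `W` (and `1` if `W` is not
invariant). -/
noncomputable def detOn (y : Module.End F V) (W : Submodule F V) : F :=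
  open Classical in if h : ∀ w ∈ W, y w ∈ W then LinearMap.det (y.restrict h) else 1

theorem detOn_of_invariant {y : Module.End F V} {W : Submodule F V} (h : ∀ w ∈ W, y w ∈ W) :
    detOn y W = LinearMap.det (y.restrict h) := by
  rw [detOn, dif_pos h]

theorem det_eq_det_of_semiconj {X Z : Type*} [AddCommGroup X] [Module F X] [AddCommGroup Z]
    [Module F Z] (e : X ≃ₗ[F] Z) {a : Module.End F X} {b : Module.End F Z}
    (h : ∀ u, e (a u) = b (e u)) : LinearMap.det a = LinearMap.det b := by
  rw [← LinearMap.det_conj a e]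
  congr 1
  ext z
  simp [h]

theorem det_eq_det_ker_mul_det {X Z : Type*} [AddCommGroup X] [Module F X] [FiniteDimensional F X]
    [AddCommGroup Z] [Module F Z] (g : X →ₗ[F] Z) (hg : Function.Surjective g)
    {a : Module.End F X} {b : Module.End F Z} (h : ∀ u, g (a u) = b (g u)) :
    LinearMap.det a = detOn a (LinearMap.ker g) * LinearMap.det b := by
  have hi : ∀ u ∈ LinearMap.ker g, a u ∈ LinearMap.ker g := fun u hu => by
    rw [LinearMap.mem_ker] at hu ⊢
    rw [h, hu, map_zero]
  rw [detOn_of_invariant hi, LinearMap.det_eq_det_mul_det (LinearMap.ker g) a hi]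
  congr 1
  refine det_eq_det_of_semiconj (g.quotKerEquivOfSurjective hg) fun u => ?_
  obtain ⟨u, rfl⟩ := Submodule.Quotient.mk_surjective _ u
  exact h u

variable {y T : Module.End F V} {W : Submodule F V}

theorem detOn_bot (y : Module.End F V) : detOn y ⊥ = 1 := by
  rw [detOn_of_invariant (by simp)]
  exact LinearMap.det_eq_one_of_subsingleton _

theorem detOn_top (y : Module.End F V) : detOn y ⊤ = LinearMap.det y := by
  rw [detOn_of_invariant (by simp)]
  exact det_eq_det_of_semiconj Submodule.topEquiv fun u => rfl

theorem detOn_eq_one (h : ∀ w ∈ W, y w = w) : detOn y W = 1 := by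
  have hi : ∀ w ∈ W, y w ∈ W := fun w hw => (h w hw).symm ▸ hw
  rw [detOn_of_invariant hi]
  convert LinearMap.det_id
  ext w
  exact h w w.2

theorem apply_comm (h : Commute y T) (u : V) : y (T u) = T (y u) :=
  LinearMap.congr_fun h u

theorem invariant_ker (h : Commute y T) : ∀ w ∈ LinearMap.ker T, y w ∈ LinearMap.ker T :=
  fun w hw => by
    rw [LinearMap.mem_ker] at hw ⊢
    rw [← apply_comm h, hw, map_zero]

theorem invariant_range (h : Commute y T) : ∀ w ∈ LinearMap.range T, y w ∈ LinearMap.range T := by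
  rintro _ ⟨w, rfl⟩
  exact ⟨y w, (apply_comm h w).symm⟩

/-- Multiplicativity of the determinant along `0 → W ⊓ ker T → W → T W → 0`. -/
theorem detOn_eq_ker_mul_map [FiniteDimensional F V] (h : Commute y T)
    (hW : ∀ w ∈ W, y w ∈ W) :
    detOn y W = detOn y (W ⊓ LinearMap.ker T) * detOn y (W.map T) := by
  have hk : ∀ w ∈ W ⊓ LinearMap.ker T, y w ∈ W ⊓ LinearMap.ker T :=
    fun w hw => ⟨hW w hw.1, invariant_ker h w hw.2⟩
  have hm : ∀ w ∈ W.map T, y w ∈ W.map T := by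
    rintro _ ⟨w, hw, rfl⟩
    exact ⟨y w, hW w hw, (apply_comm h w).symm⟩
  have key := det_eq_det_ker_mul_det (T.submoduleMap W) (T.submoduleMap_surjective W)
    (a := y.restrict hW) (b := y.restrict hm)
    fun u => Subtype.ext (apply_comm h u).symm
  rw [detOn_of_invariant hW, key, detOn_of_invariant hm]
  congr 1
  have hk' : ∀ w ∈ LinearMap.ker (T.submoduleMap W),
      y.restrict hW w ∈ LinearMap.ker (T.submoduleMap W) := fun w hw => by
    have h0 : T w = 0 := congrArg Subtype.val hw
    refine Subtype.ext ?_
    change T (y w) = 0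
    rw [← apply_comm h, h0, map_zero]
  rw [detOn_of_invariant hk', detOn_of_invariant hk]
  refine det_eq_det_of_semiconj
    (LinearEquiv.ofLinearMap
      ((W.subtype.comp (LinearMap.ker (T.submoduleMap W)).subtype).codRestrict
        (W ⊓ LinearMap.ker T) fun w => ⟨w.1.2, congrArg Subtype.val w.2⟩)
      (((W ⊓ LinearMap.ker T).subtype.codRestrict W fun w => w.2.1).codRestrict _
        fun w => Subtype.ext w.2.2) ?_ ?_) fun u => rfl
  · ext; rfl
  · ext; rfl

theorem det_eq_ker_mul_range [FiniteDimensional F V] (h : Commute y T) :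
    LinearMap.det y = detOn y (LinearMap.ker T) * detOn y (LinearMap.range T) := by
  rw [← detOn_top, detOn_eq_ker_mul_map h (by simp), top_inf_eq, Submodule.map_top]

/-- `T` has a Jordan block of size `m`: some vector in the kernel of `T ^ m` is mapped by
`T ^ (m - 1)` outside of the range of `T ^ m`. -/
def HasBlock (T : Module.End F V) (m : ℕ) : Prop :=
  ∃ v, (T ^ m) v = 0 ∧ (T ^ (m - 1)) v ∉ LinearMap.range (T ^ m)

/-- Identifies `ker (N ^ (i + 1)) / ker (N ^ i)` with the `i`-th layer, whose dimension counts the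
Jordan blocks of size greater than `i`. -/
theorem map_pow_ker_pow (N : Module.End F V) (i : ℕ) :
    (LinearMap.ker (N ^ (i + 1))).map (N ^ i) = LinearMap.ker N ⊓ LinearMap.range (N ^ i) := by
  ext w
  simp only [Submodule.mem_map, LinearMap.mem_ker, Submodule.mem_inf, LinearMap.mem_range]
  constructor
  · rintro ⟨v, hv, rfl⟩
    rw [pow_succ'] at hv
    exact ⟨hv, v, rfl⟩
  · rintro ⟨hw, v, rfl⟩
    refine ⟨v, ?_, rfl⟩
    rw [pow_succ']
    exact hw

theorem detOn_ker_pow_succ [FiniteDimensional F V] {N : Module.End F V} (h : Commute y N) (i : ℕ) :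
    detOn y (LinearMap.ker (N ^ (i + 1))) =
      detOn y (LinearMap.ker (N ^ i)) *
        detOn y (LinearMap.ker N ⊓ LinearMap.range (N ^ i)) := by
  rw [detOn_eq_ker_mul_map (h.pow_right i) (invariant_ker (h.pow_right (i + 1))), map_pow_ker_pow]
  congr 2
  rw [inf_eq_right]
  intro w hw
  rw [LinearMap.mem_ker] at hw ⊢
  rw [pow_succ', Module.End.mul_apply, hw, map_zero]

theorem detOn_ker_pow_eq_prod [FiniteDimensional F V] {N : Module.End F V} (h : Commute y N)
    (n : ℕ) : detOn y (LinearMap.ker (N ^ n)) =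
      ∏ i ∈ Finset.range n, detOn y (LinearMap.ker N ⊓ LinearMap.range (N ^ i)) := by
  induction n with
  | zero =>
    rw [pow_zero, Finset.prod_range_zero]
    convert detOn_bot y
    exact LinearMap.ker_id
  | succ n ih => rw [detOn_ker_pow_succ h, ih, Finset.prod_range_succ]

/-- A vector `N ^ i v` of the `i`-th layer outside the next one makes `v` a witness for a block of
size `i + 1`. -/
theorem ker_inf_range_eq_of_not_hasBlock {N : Module.End F V} {i : ℕ}
    (h : ¬ HasBlock N (i + 1)) :
    LinearMap.ker N ⊓ LinearMap.range (N ^ (i + 1)) = LinearMap.ker N ⊓ LinearMap.range (N ^ i) := by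
  apply le_antisymm
  · rintro w ⟨hw, v, rfl⟩
    exact ⟨hw, N v, by rw [pow_succ]; rfl⟩
  · rintro w ⟨hw, v, rfl⟩
    refine ⟨hw, by_contra fun hv => h ⟨v, ?_, hv⟩⟩
    rw [pow_succ']
    exact hw

theorem detOn_layer_eq {N : Module.End F V} {d : ℕ}
    (hd : ∀ m, 0 < m → HasBlock N m → d ∣ m) (j r : ℕ) (hr : r < d) :
    detOn y (LinearMap.ker N ⊓ LinearMap.range (N ^ (d * j + r))) =
      detOn y (LinearMap.ker N ⊓ LinearMap.range (N ^ (d * j))) := by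
  induction r with
  | zero => rfl
  | succ r ih =>
    rw [← ih (by omega), ← add_assoc, ker_inf_range_eq_of_not_hasBlock]
    intro hb
    have h1 := hd _ (Nat.succ_pos _) hb
    rw [Nat.succ_eq_add_one, add_assoc, Nat.dvd_add_right (dvd_mul_right d j)] at h1
    exact absurd (Nat.le_of_dvd (Nat.succ_pos _) h1) (by omega)

/-- Block sizes are multiples of `d`, so the layers with indices `d * j, …, d * j + d - 1` are equal
and contribute a `d`-th power. -/
theorem detOn_ker_pow_mul [FiniteDimensional F V] {N : Module.End F V} (h : Commute y N) {d : ℕ}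
    (hd : ∀ m, 0 < m → HasBlock N m → d ∣ m) (L : ℕ) :
    detOn y (LinearMap.ker (N ^ (d * L))) =
      (∏ j ∈ Finset.range L, detOn y (LinearMap.ker N ⊓ LinearMap.range (N ^ (d * j)))) ^ d := by
  rw [detOn_ker_pow_eq_prod h]
  induction L with
  | zero => simp
  | succ L ih =>
    rw [mul_add, mul_one, Finset.prod_range_add, ih, Finset.prod_range_succ, mul_pow]
    congr 1
    rw [Finset.prod_congr rfl fun r hr => detOn_layer_eq hd L r (Finset.mem_range.1 hr),
      Finset.prod_const, Finset.card_range]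

/-- The nilpotent map `y + 1` has characteristic polynomial `X ^ n`, whose value at `1` is `det
(-y)`. -/
theorem det_add_one_eq_of_nilpotent [FiniteDimensional F V] (h : IsNilpotent (y + 1)) :
    LinearMap.det y = (-1) ^ Module.finrank F V := by
  have h1 := LinearMap.eval_charpoly (y + 1) 1
  rw [_root_.IsNilpotent.charpoly_eq_X_pow_finrank h, eval_pow, eval_X, one_pow, map_one] at h1
  have h2 : y = (-1 : F) • (1 - (y + 1)) := by
    ext; simp
  rw [h2, LinearMap.det_smul, ← h1, mul_one]

end DetOn

/-! ### Gram determinants and forms induced on ranges -/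

section Forms

variable {F V : Type*} [Field F] [AddCommGroup V] [Module F V] {σ : F →+* F}

section Gram

variable {ι : Type*} [Fintype ι] [DecidableEq ι]

/-- The Gram matrix of a form with respect to a basis. -/
noncomputable def gram (γ : V →ₗ[F] V →ₛₗ[σ] F) (b : Module.Basis ι F V) : Matrix ι ι F :=
  Matrix.of fun i j => γ (b i) (b j)

omit [DecidableEq ι] in
theorem apply_eq_sum (γ : V →ₗ[F] V →ₛₗ[σ] F) (b : Module.Basis ι F V) (u v : V) :
    γ u v = ∑ i, ∑ j, b.repr u i * (σ (b.repr v j) * gram γ b i j) := by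
  conv_lhs => rw [← b.sum_repr u, ← b.sum_repr v]
  simp only [map_sum, LinearMap.sum_apply, map_smul, LinearMap.smul_apply, smul_eq_mul,
    map_smulₛₗ, gram, Matrix.of_apply, Finset.mul_sum]
  rw [Finset.sum_comm]
  exact Finset.sum_congr rfl fun i _ => Finset.sum_congr rfl fun j _ => by ring

theorem det_gram_ne_zero {γ : V →ₗ[F] V →ₛₗ[σ] F} (hγ : γ.SeparatingLeft)
    (b : Module.Basis ι F V) : (gram γ b).det ≠ 0 := by
  intro h0
  obtain ⟨c, hc, hc0⟩ := Matrix.exists_vecMul_eq_zero_iff.2 h0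
  apply hc
  have h1 : ∑ i, c i • b i = 0 := by
    refine hγ _ fun v => ?_
    rw [← b.sum_repr v]
    simp only [map_sum, map_smulₛₗ, LinearMap.sum_apply, LinearMap.smul_apply, RingHom.id_apply]
    refine Finset.sum_eq_zero fun j _ => ?_
    have := congrFun hc0 j
    simp only [Matrix.vecMul, dotProduct, gram, Matrix.of_apply, Pi.zero_apply] at this
    simp only [smul_eq_mul]
    rw [this, mul_zero]
  ext i
  exact Fintype.linearIndependent_iff.1 b.linearIndependent c h1 i

theorem gram_map (γ : V →ₗ[F] V →ₛₗ[σ] F) (b : Module.Basis ι F V) (A C : Module.End F V) :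
    (Matrix.of fun i j => γ (A (b i)) (C (b j))) =
      (LinearMap.toMatrix b b A).transpose * gram γ b * (LinearMap.toMatrix b b C).map σ := by
  ext i j
  rw [Matrix.of_apply, apply_eq_sum γ b, Finset.sum_comm]
  simp only [Matrix.mul_apply, Matrix.transpose_apply, LinearMap.toMatrix_apply, Matrix.map_apply,
    Finset.sum_mul]
  exact Finset.sum_congr rfl fun k _ => Finset.sum_congr rfl fun l _ => by ring

end Gram

variable [FiniteDimensional F V]

/-- Adjoint endomorphisms have conjugate determinants. -/
theorem det_eq_map_det_of_adjoint {γ : V →ₗ[F] V →ₛₗ[σ] F} (hγ : γ.SeparatingLeft)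
    {A C : Module.End F V} (h : ∀ u v, γ (A u) v = γ u (C v)) :
    LinearMap.det A = σ (LinearMap.det C) := by
  have b := Module.finBasis F V
  have h1 := gram_map γ b A 1
  have h2 := gram_map γ b 1 C
  simp only [Module.End.one_apply, h] at h1 h2
  rw [h1] at h2
  have h3 := congrArg Matrix.det h2
  have h4 : ∀ D : Module.End F V, ((LinearMap.toMatrix b b D).map σ).det = σ (LinearMap.det D) :=
    fun D => by rw [← LinearMap.det_toMatrix b, RingHom.map_det]; rfl
  rw [Matrix.det_mul, Matrix.det_mul, Matrix.det_mul, Matrix.det_mul, h4, h4, Matrix.det_transpose,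
    Matrix.det_transpose, LinearMap.det_toMatrix, LinearMap.det_toMatrix, map_one, map_one,
    mul_one, one_mul, mul_comm] at h3
  exact mul_left_cancel₀ (det_gram_ne_zero hγ b) h3

theorem det_mul_map_det_of_isometry {γ : V →ₗ[F] V →ₛₗ[σ] F} (hγ : γ.SeparatingLeft)
    {A : Module.End F V} (h : ∀ u v, γ (A u) (A v) = γ u v) :
    LinearMap.det A * σ (LinearMap.det A) = 1 := by
  have b := Module.finBasis F V
  have h1 := gram_map γ b A A
  simp only [h] at h1
  have h3 := congrArg Matrix.det h1
  have h4 : ((LinearMap.toMatrix b b A).map σ).det = σ (LinearMap.det A) := by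
    rw [← LinearMap.det_toMatrix b, RingHom.map_det]; rfl
  rw [Matrix.det_mul, Matrix.det_mul, h4, Matrix.det_transpose, LinearMap.det_toMatrix] at h3
  apply mul_left_cancel₀ (det_gram_ne_zero hγ b)
  rw [mul_one, mul_left_comm, ← mul_assoc]
  exact h3.symm

/-- The identity `γ (A u) ((A + 1) v) = γ ((1 + A) u) v` gives `det A * det (A + 1) = det (1 + A)`,
and `-1` not being an eigenvalue allows cancellation. -/
theorem det_eq_one_of_isometry {γ : V →ₗ[F] V →ₗ[F] F} (hγ : γ.SeparatingLeft)
    {A : Module.End F V} (h : ∀ u v, γ (A u) (A v) = γ u v) (hA : ∀ u, A u + u = 0 → u = 0) :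
    LinearMap.det A = 1 := by
  have hu : LinearMap.det (A + 1) ≠ 0 := by
    intro h0
    refine (LinearMap.bot_lt_ker_of_det_eq_zero h0).ne' ?_
    rw [LinearMap.ker_eq_bot']
    exact fun u hu => hA u hu
  have b := Module.finBasis F V
  have h1 := gram_map γ b A (A + 1)
  have h2 := gram_map γ b (1 + A) 1
  have h3 : ∀ u v, γ (A u) ((A + 1) v) = γ ((1 + A) u) ((1 : Module.End F V) v) := fun u v => by
    simp [h]
  simp only [h3] at h1
  rw [h1] at h2
  have h5 := congrArg Matrix.det h2
  have h4 : ∀ D : Module.End F V,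
      ((LinearMap.toMatrix b b D).map (RingHom.id F)).det = LinearMap.det D :=
    fun D => by rw [← LinearMap.det_toMatrix b]; congr 1
  rw [Matrix.det_mul, Matrix.det_mul, Matrix.det_mul, Matrix.det_mul, h4, h4, Matrix.det_transpose,
    Matrix.det_transpose, LinearMap.det_toMatrix, LinearMap.det_toMatrix, map_one,
    mul_one, add_comm 1 A] at h5
  apply mul_right_cancel₀ (mul_ne_zero (det_gram_ne_zero hγ b) hu)
  rw [← mul_assoc, h5, one_mul, mul_comm]

theorem even_finrank_of_skew (h2 : (2 : F) ≠ 0) {γ : V →ₗ[F] V →ₗ[F] F} (hγ : γ.SeparatingLeft)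
    (h : ∀ u v, γ u v = -γ v u) : Even (Module.finrank F V) := by
  have b := Module.finBasis F V
  have h1 : (gram γ b).transpose = -gram γ b := by
    ext i j
    exact h _ _
  have h3 := congrArg Matrix.det h1
  rw [Matrix.det_transpose, Matrix.det_neg, Fintype.card_fin] at h3
  by_contra hodd
  rw [Nat.not_even_iff_odd] at hodd
  rw [hodd.neg_one_pow] at h3
  have h4 : 2 * (gram γ b).det = 0 := by linear_combination h3
  exact (mul_ne_zero h2 (det_gram_ne_zero hγ b)) h4

section RangeForm

variable {β : V →ₗ[F] V →ₛₗ[σ] F} {T : Module.End F V}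

omit [FiniteDimensional F V] in
/-- If `ker T` is the left orthogonal of `range T`, then `β` induces the form
`(T u, w) ↦ β u w` on `range T`. -/
theorem exists_rangeForm (hT : ∀ u, T u = 0 ↔ ∀ v, β u (T v) = 0) :
    ∃ γ : LinearMap.range T →ₗ[F] LinearMap.range T →ₛₗ[σ] F, γ.SeparatingLeft ∧
      ∀ (r r' : LinearMap.range T) (u : V), T u = r → γ r r' = β u r' := by
  obtain ⟨s, hs⟩ := T.rangeRestrict.exists_rightInverse_of_surjective T.range_rangeRestrict
  have hs' : ∀ r, T (s r) = r := fun r => congrArg Subtype.val (LinearMap.congr_fun hs r)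
  refine ⟨LinearMap.mk₂'ₛₗ (RingHom.id F) σ (fun r r' => β (s r) (r' : V)) (by simp) (by simp)
    (by simp) (by simp), fun r hr => ?_, fun r r' u hu => ?_⟩
  · refine Subtype.ext ?_
    rw [← hs' r]
    exact (hT _).2 fun v => hr ⟨T v, v, rfl⟩
  · change β (s r) r' = β u r'
    rw [← sub_eq_zero, ← LinearMap.sub_apply, ← map_sub]
    obtain ⟨v, hv⟩ := r'.2
    rw [← hv]
    exact (hT _).1 (by rw [map_sub, hs', hu, sub_self]) v

variable {y : Module.End F V}

theorem detOn_range_mul_map (hT : ∀ u, T u = 0 ↔ ∀ v, β u (T v) = 0) (h : Commute y T)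
    (hy : ∀ u v, β (y u) (y v) = β u v) :
    detOn y (LinearMap.range T) * σ (detOn y (LinearMap.range T)) = 1 := by
  obtain ⟨γ, hγ, hγ'⟩ := exists_rangeForm hT
  rw [detOn_of_invariant (invariant_range h)]
  refine det_mul_map_det_of_isometry hγ fun r r' => ?_
  obtain ⟨u, hu⟩ := r.2
  rw [hγ' r r' u hu, hγ' _ _ (y u) (by rw [← apply_comm h, hu]; rfl)]
  exact hy _ _

/-- Both the full determinant and the one on the range have norm one, hence so does their quotient,
the determinant on the kernel. -/
theorem detOn_ker_mul_map (hβ : β.SeparatingLeft) (hT : ∀ u, T u = 0 ↔ ∀ v, β u (T v) = 0)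
    (h : Commute y T) (hy : ∀ u v, β (y u) (y v) = β u v) :
    detOn y (LinearMap.ker T) * σ (detOn y (LinearMap.ker T)) = 1 := by
  have h1 := det_mul_map_det_of_isometry hβ hy
  have h2 := detOn_range_mul_map hT h hy
  rw [det_eq_ker_mul_range h, map_mul] at h1
  linear_combination h1 - detOn y (LinearMap.ker T) * σ (detOn y (LinearMap.ker T)) * h2

theorem detOn_range_eq_one {β : V →ₗ[F] V →ₗ[F] F} (hT : ∀ u, T u = 0 ↔ ∀ v, β u (T v) = 0)
    (h : Commute y T) (hy : ∀ u v, β (y u) (y v) = β u v)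
    (h1 : ∀ u ∈ LinearMap.range T, y u + u = 0 → u = 0) :
    detOn y (LinearMap.range T) = 1 := by
  obtain ⟨γ, hγ, hγ'⟩ := exists_rangeForm hT
  rw [detOn_of_invariant (invariant_range h)]
  refine det_eq_one_of_isometry hγ (fun r r' => ?_) fun r hr => ?_
  · obtain ⟨u, hu⟩ := r.2
    rw [hγ' r r' u hu, hγ' _ _ (y u) (by rw [← apply_comm h, hu]; rfl)]
    exact hy _ _
  · exact Subtype.ext (h1 r r.2 (congrArg Subtype.val hr))

omit [FiniteDimensional F V] in
theorem separating_of_adjoint {c : F} (hc : c ≠ 0) (hβ : β.SeparatingLeft)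
    (hT : ∀ u v, β (T u) v = c * β u (T v)) (u : V) : T u = 0 ↔ ∀ v, β u (T v) = 0 := by
  constructor
  · intro h v
    have := hT u v
    rw [h, map_zero, LinearMap.zero_apply] at this
    exact (mul_eq_zero.1 this.symm).resolve_left hc
  · intro h
    refine hβ _ fun v => ?_
    rw [hT, h, mul_zero]

/-- For skew-adjoint `T` the induced form `(T u, w) ↦ β u w` on the range is itself skew-symmetric.
-/
theorem even_finrank_range_of_skew {β : V →ₗ[F] V →ₗ[F] F} (h2 : (2 : F) ≠ 0)
    (hβ : β.SeparatingLeft) (hs : ∀ u v, β u v = β v u) (hT : ∀ u v, β (T u) v = -β u (T v)) :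
    Even (Module.finrank F (LinearMap.range T)) := by
  obtain ⟨γ, hγ, hγ'⟩ := exists_rangeForm (β := β) (T := T)
    (separating_of_adjoint (c := -1) (by simp) hβ (by simpa using hT))
  refine even_finrank_of_skew h2 hγ fun r r' => ?_
  obtain ⟨u, hu⟩ := r.2
  obtain ⟨u', hu'⟩ := r'.2
  rw [hγ' r r' u hu, hγ' r' r u' hu', ← hu, ← hu', hs, hT]

end RangeForm

end Forms

/-! ### Jordan blocks and elementary divisors -/

section Divisors

variable {F V : Type*} [Field F] [AddCommGroup V] [Module F V]

/-- This is the absence of blocks of size `m` for multiplication by `P` on one cyclic module `F[X] /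
(g ^ e)`. As `P` is squarefree, it acts either invertibly or as `g` times a unit; in the latter case
the only block size is `e`. -/
theorem exists_dvd_sub_of_squarefree {g P a : F[X]} (hg : Irreducible g) (hP : Squarefree P)
    {e m : ℕ} (hm : 0 < m) (h : g ^ e ∣ P ^ m * a) (hne : ¬ (g ∣ P ∧ e = m)) :
    ∃ w, g ^ e ∣ P ^ m * w - P ^ (m - 1) * a := by
  obtain ⟨m, rfl⟩ : ∃ n, m = n + 1 := ⟨m - 1, by omega⟩
  rw [Nat.add_sub_cancel]
  by_cases hgP : g ∣ P
  · obtain ⟨c, rfl⟩ := hgP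
    have hc : IsCoprime g c := by
      refine (hg.coprime_iff_not_dvd).2 fun hgc => hg.not_isUnit (hP g ?_)
      exact mul_dvd_mul_left g hgc
    rcases lt_trichotomy e (m + 1) with hlt | heq | hgt
    · refine ⟨0, ?_⟩
      rw [mul_zero, zero_sub, dvd_neg, mul_pow, mul_assoc]
      exact (pow_dvd_pow g (by omega)).trans (dvd_mul_right _ _)
    · exact absurd ⟨dvd_mul_right _ _, heq⟩ hne
    · obtain ⟨t, rfl⟩ : ∃ t, e = (m + 1) + (t + 1) := ⟨e - m - 2, by omega⟩
      rw [mul_pow, mul_assoc, pow_add, mul_dvd_mul_iff_left (pow_ne_zero _ hg.ne_zero)] at h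
      obtain ⟨b, rfl⟩ := (IsCoprime.pow hc : IsCoprime (g ^ (t + 1)) (c ^ (m + 1))).dvd_of_dvd_mul_left h
      obtain ⟨r, s, hrs⟩ := (IsCoprime.pow_left hc : IsCoprime (g ^ (m + 1 + (t + 1))) c)
      -- Here `g ^ (t + 1)` divides `a`, so `a` can be divided by `P = g * c`: one factor `g` is
      -- removed and `c` is inverted modulo `g ^ e` by `s`.
      refine ⟨s * g ^ t * b, -((g * c) ^ m * g * r * g ^ t * b), ?_⟩
      linear_combination (g * c) ^ m * g * g ^ t * b * hrs
  · have hc : IsCoprime (g ^ e) (P ^ (m + 1)) :=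
      IsCoprime.pow ((hg.coprime_iff_not_dvd).2 hgP)
    refine ⟨0, ?_⟩
    rw [mul_zero, zero_sub, dvd_neg]
    exact (hc.dvd_of_dvd_mul_left h).mul_left _

/-- The structure theorem over `F[X]`, after discarding the trivial summands with exponent `0` and
normalizing the primes to be monic. -/
theorem exists_hasElementaryDivisors [FiniteDimensional F V] (x : Module.End F V) :
    ∃ (k : ℕ) (f : Fin k → F[X]) (m : Fin k → ℕ), HasElementaryDivisors x f m := by
  classical
  obtain ⟨ι, _, p, hp, e, ⟨ψ⟩⟩ := Module.equiv_directSum_of_isTorsion (R := F[X])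
    (M := Module.AEval' x) (Module.AEval.isTorsion_of_finiteDimensional F V x)
  let φ := (Fintype.equivFin {i // 0 < e i}).symm
  have hs : ∀ j, Submodule.span F[X] {p (φ j) ^ e (φ j)} =
      Ideal.span {normalize (p (φ j)) ^ e (φ j)} := fun j => by
    refine Ideal.span_singleton_eq_span_singleton.2 ?_
    exact (normalize_associated (p (φ j))).symm.pow_pow
  let L : (∀ i, F[X] ⧸ Submodule.span F[X] {p i ^ e i}) →ₗ[F[X]]
      ∀ j, F[X] ⧸ Ideal.span {normalize (p (φ j)) ^ e (φ j)} :=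
    LinearMap.pi fun j => (Submodule.quotEquivOfEq _ _ (hs j)).toLinearMap.comp
      (LinearMap.proj (φ j : ι))
  have hL : Function.Bijective L := by
    constructor
    · rw [← LinearMap.ker_eq_bot, LinearMap.ker_eq_bot']
      intro u hu
      ext i
      rcases Nat.eq_zero_or_pos (e i) with h0 | h0
      · have : Subsingleton (F[X] ⧸ Submodule.span F[X] {p i ^ e i}) := by
          rw [h0, pow_zero]
          exact Ideal.Quotient.subsingleton_iff.2 Ideal.span_singleton_one
        exact Subsingleton.elim _ _
      · have h1 := congrFun hu (φ.symm ⟨i, h0⟩)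
        have h2 := (LinearEquiv.map_eq_zero_iff (Submodule.quotEquivOfEq _ _ (hs _))).1 h1
        have h3 : ∀ s : {i // 0 < e i}, s = ⟨i, h0⟩ → u s = 0 → u i = 0 := by
          rintro _ rfl h; exact h
        exact h3 _ (φ.apply_symm_apply _) h2
    · intro z
      choose a ha using fun j => Ideal.Quotient.mk_surjective (z j)
      refine ⟨fun i => if h0 : 0 < e i then
        Submodule.Quotient.mk (a (φ.symm ⟨i, h0⟩)) else 0, ?_⟩
      ext j
      rw [← ha j]
      change Submodule.quotEquivOfEq _ _ (hs j) (dite _ _ _) = _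
      rw [dif_pos (φ j).2, Submodule.quotEquivOfEq_mk]
      exact congrArg (fun j => Submodule.Quotient.mk (a j)) (φ.symm_apply_apply j)
  refine ⟨_, fun j => normalize (p (φ j)), fun j => e (φ j), fun j => ?_, fun j => ?_,
    fun j => (φ j).2, ⟨?_⟩⟩
  · exact Polynomial.monic_normalize (hp _).ne_zero
  · exact (normalize_associated _).symm.irreducible (hp _)
  · exact ψ.trans ((DirectSum.linearEquivFunOnFintype F[X] ι _).trans
      ((LinearEquiv.ofBijective L hL).trans (DirectSum.linearEquivFunOnFintype F[X] _ _).symm))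

variable {x : Module.End F V}

theorem smul_quotient_eq_zero {f : F[X]} (z : F[X] ⧸ Ideal.span {f}) : f • z = 0 := by
  obtain ⟨a, rfl⟩ := Ideal.Quotient.mk_surjective z
  change Ideal.Quotient.mk _ (f * a) = 0
  rw [Ideal.Quotient.eq_zero_iff_dvd]
  exact dvd_mul_right _ _

theorem IsElementaryDivisor.hasBlock {f : F[X]} {m : ℕ} (h : IsElementaryDivisor x f m) :
    f.Monic ∧ Irreducible f ∧ 0 < m ∧ HasBlock (aeval x f) m := by
  obtain ⟨k, g, e, hge, i, rfl, rfl⟩ := h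
  refine ⟨hge.monic i, hge.irreducible i, hge.pos i, ?_⟩
  obtain ⟨ψ⟩ := hge.decomposition
  have hψ : ∀ (p : F[X]) (v : V), ψ (Module.AEval'.of x (aeval x p v)) =
      p • ψ (Module.AEval'.of x v) := fun p v => by
    rw [← map_smul]; rfl
  -- The generator of the `i`-th summand: its annihilator is generated by `g i ^ e i`, so `g i ^ (e
  -- i - 1)` does not kill it.
  let u := DirectSum.lof F[X] (Fin k) (fun i => F[X] ⧸ Ideal.span {g i ^ e i}) i 1
  obtain ⟨v, hv⟩ : ∃ v, ψ (Module.AEval'.of x v) = u :=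
    ⟨(Module.AEval'.of x).symm (ψ.symm u), by simp⟩
  refine ⟨v, ?_, ?_⟩
  · have h1 := hψ (g i ^ e i) v
    rw [hv, ← map_smul, smul_quotient_eq_zero, map_zero, map_pow] at h1
    simpa using h1
  · rintro ⟨w, hw⟩
    rw [← map_pow, ← map_pow] at hw
    have h1 := hψ (g i ^ (e i - 1)) v
    rw [← hw, hψ, hv] at h1
    have h2 := congrArg (DirectSum.component F[X] _ _ i) h1
    rw [map_smul, map_smul, smul_quotient_eq_zero, DirectSum.component.lof_self] at h2
    have h3 : Ideal.Quotient.mk (Ideal.span {g i ^ e i}) (g i ^ (e i - 1) * 1) = 0 := h2.symm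
    rw [Ideal.Quotient.eq_zero_iff_dvd, mul_one] at h3
    have h4 := (pow_dvd_pow_iff (hge.irreducible i).ne_zero (hge.irreducible i).not_isUnit).1 h3
    have := hge.pos i
    omega

/-- If no summand had a block of size `m` for `P`, the equation `P ^ m w = P ^ (m - 1) v` could be
solved componentwise, contradicting the block. -/
theorem exists_isElementaryDivisor_of_hasBlock [FiniteDimensional F V] {P : F[X]}
    (hP : Squarefree P) {m : ℕ} (hm : 0 < m) (h : HasBlock (aeval x P) m) :
    ∃ f, f ∣ P ∧ IsElementaryDivisor x f m := by
  obtain ⟨k, g, e, hge⟩ := exists_hasElementaryDivisors x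
  by_contra hcon
  push Not at hcon
  have hne : ∀ i, ¬ (g i ∣ P ∧ e i = m) := fun i hi => hcon _ hi.1 ⟨k, g, e, hge, i, rfl, hi.2⟩
  obtain ⟨ψ⟩ := hge.decomposition
  have hψ : ∀ (p : F[X]) (v : V), ψ (Module.AEval'.of x (aeval x p v)) =
      p • ψ (Module.AEval'.of x v) := fun p v => by
    rw [← map_smul]; rfl
  obtain ⟨v, hv, hv'⟩ := h
  apply hv'
  rw [← map_pow] at hv
  have key : ∀ i, ∃ w : F[X] ⧸ Ideal.span {g i ^ e i},
      P ^ m • w = P ^ (m - 1) • (ψ (Module.AEval'.of x v)) i := fun i => by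
    have h1 := hψ (P ^ m) v
    rw [hv, map_zero, map_zero] at h1
    have h2 := congrArg (DirectSum.component F[X] _ _ i) h1
    rw [map_zero, map_smul] at h2
    change 0 = P ^ m • (ψ (Module.AEval'.of x v)) i at h2
    obtain ⟨a, ha⟩ := Ideal.Quotient.mk_surjective ((ψ (Module.AEval'.of x v)) i)
    rw [← ha] at h2 ⊢
    have h3 : Ideal.Quotient.mk (Ideal.span {g i ^ e i}) (P ^ m * a) = 0 := h2.symm
    rw [Ideal.Quotient.eq_zero_iff_dvd] at h3
    obtain ⟨w, hw⟩ := exists_dvd_sub_of_squarefree (hge.irreducible i) hP hm h3 (hne i)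
    refine ⟨Ideal.Quotient.mk _ w, ?_⟩
    rw [← Ideal.Quotient.eq_zero_iff_dvd, map_sub, sub_eq_zero] at hw
    exact hw
  choose w hw using key
  let W := (DirectSum.linearEquivFunOnFintype F[X] (Fin k)
    (fun i => F[X] ⧸ Ideal.span {g i ^ e i})).symm w
  refine ⟨(Module.AEval'.of x).symm (ψ.symm W), ?_⟩
  apply (Module.AEval'.of x).injective
  apply ψ.injective
  rw [← map_pow, ← map_pow, hψ, hψ]
  simp only [LinearEquiv.apply_symm_apply]
  apply (DirectSum.linearEquivFunOnFintype F[X] (Fin k)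
    (fun i => F[X] ⧸ Ideal.span {g i ^ e i})).injective
  rw [map_smul, map_smul, LinearEquiv.apply_symm_apply]
  ext i
  exact hw i

theorem exists_isElementaryDivisor [FiniteDimensional F V] [Nontrivial V] (x : Module.End F V) :
    ∃ f m, IsElementaryDivisor x f m := by
  obtain ⟨k, g, e, hge⟩ := exists_hasElementaryDivisors x
  rcases Nat.eq_zero_or_pos k with rfl | hk
  · obtain ⟨ψ⟩ := hge.decomposition
    have : Subsingleton V := ⟨fun u v => (Module.AEval'.of x).injective <| ψ.injective <|
      (DirectSum.linearEquivFunOnFintype F[X] (Fin 0) _).injective (Subsingleton.elim _ _)⟩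
    exact absurd this (not_subsingleton V)
  · exact ⟨_, _, k, g, e, hge, ⟨0, hk⟩, rfl, rfl⟩

end Divisors

/-! ### Class splitting as a subgroup index -/

section Splitting

variable {G A : Type*} [Group G] [CommGroup A]

/-- The number of classes of the kernel of `χ` in a conjugacy class is the index of the image of
the centralizer in the image of the group. -/
theorem ncard_classesInside_ker (χ : G →* A) (x : χ.ker) :
    (classesInside χ.ker x).ncard = ((Subgroup.centralizer {(x : G)}).map χ).relIndex χ.range := by
  have hmem : ∀ g : G, g * x * g⁻¹ ∈ χ.ker := fun g => (χ.normal_ker).conj_mem _ x.2 g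
  let Θ : G → ConjClasses χ.ker := fun g => ConjClasses.mk ⟨g * x * g⁻¹, hmem g⟩
  let H := ((Subgroup.centralizer {(x : G)}).map χ).subgroupOf χ.range
  let Ψ : G → χ.range ⧸ H := fun g => QuotientGroup.mk (χ.rangeRestrict g)⁻¹
  have hrange : classesInside χ.ker x = Set.range Θ := by
    ext c
    constructor
    · intro hc
      obtain ⟨z, rfl⟩ := ConjClasses.exists_rep c
      obtain ⟨g, hg⟩ := isConj_iff.1 (hc z rfl)
      exact ⟨g, congrArg ConjClasses.mk (Subtype.ext hg)⟩
    · rintro ⟨g, rfl⟩ z hz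
      obtain ⟨s, hs⟩ := isConj_iff.1 (ConjClasses.mk_eq_mk_iff_isConj.1 hz.symm)
      refine isConj_iff.2 ⟨s * g, ?_⟩
      rw [← hs]
      simp [mul_assoc]
  have hΨ : Function.Surjective Ψ := by
    intro c
    obtain ⟨r, rfl⟩ := QuotientGroup.mk_surjective c
    obtain ⟨g, hg⟩ := χ.rangeRestrict_surjective r⁻¹
    exact ⟨g, by simp [Ψ, hg]⟩
  -- The conjugates of `x` by `g` and `g'` are conjugate under the kernel exactly when `g'⁻¹ * s *
  -- g` centralizes `x` for some `s` in the kernel, i.e. when `χ g * (χ g')⁻¹` is the image of a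
  -- centralizing element.
  have hker : Setoid.ker Θ = Setoid.ker Ψ := by
    ext g g'
    rw [Setoid.ker_def, Setoid.ker_def]
    simp only [Θ, Ψ]
    rw [ConjClasses.mk_eq_mk_iff_isConj, isConj_iff, QuotientGroup.eq, Subgroup.mem_subgroupOf]
    constructor
    · rintro ⟨s, hs⟩
      have hs' : (s : G) * (g * x * g⁻¹) * (s : G)⁻¹ = g' * x * g'⁻¹ := congrArg Subtype.val hs
      refine ⟨g'⁻¹ * s * g, ?_, ?_⟩
      · rw [SetLike.mem_coe, Subgroup.mem_centralizer_singleton_iff]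
        calc g'⁻¹ * s * g * x = g'⁻¹ * (s * (g * x * g⁻¹) * (s : G)⁻¹) * s * g := by group
          _ = _ := by rw [hs']; group
      · have : χ s = 1 := s.2
        simp [this, mul_comm]
    · rintro ⟨c, hc, hc'⟩
      rw [SetLike.mem_coe, Subgroup.mem_centralizer_singleton_iff] at hc
      have hcχ : χ c = χ g * (χ g')⁻¹ := by simpa using hc'
      refine ⟨⟨g' * c * g⁻¹, ?_⟩, Subtype.ext ?_⟩
      · rw [MonoidHom.mem_ker, map_mul, map_mul, map_inv, hcχ]
        simp
      · change g' * c * g⁻¹ * (g * x * g⁻¹) * (g' * c * g⁻¹)⁻¹ = g' * x * g'⁻¹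
        calc g' * c * g⁻¹ * (g * x * g⁻¹) * (g' * c * g⁻¹)⁻¹ = g' * (c * x) * c⁻¹ * g'⁻¹ := by group
          _ = _ := by rw [hc]; group
  rw [hrange, ← Nat.card_coe_set_eq, Subgroup.relIndex, Subgroup.index]
  calc Nat.card (Set.range Θ) = Nat.card (Quotient (Setoid.ker Θ)) :=
        (Nat.card_congr (Setoid.quotientKerEquivRange Θ)).symm
    _ = Nat.card (Quotient (Setoid.ker Ψ)) := by rw [hker]
    _ = _ := Nat.card_congr (Setoid.quotientKerEquivOfSurjective Ψ hΨ)

theorem pow_gcd_mem {H : Subgroup A} {a : A} {m n : ℕ} (hm : a ^ m ∈ H) (hn : a ^ n ∈ H) :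
    a ^ Nat.gcd m n ∈ H := by
  rw [← zpow_natCast, Nat.gcd_eq_gcd_ab, zpow_add, zpow_mul, zpow_mul, zpow_natCast, zpow_natCast]
  exact H.mul_mem (H.zpow_mem hm _) (H.zpow_mem hn _)

theorem pow_finset_gcd_mem {ι : Type*} {H : Subgroup A} {a : A} (s : Finset ι) {m : ι → ℕ}
    (h : ∀ i ∈ s, a ^ m i ∈ H) : a ^ s.gcd m ∈ H := by
  classical
  induction s using Finset.induction_on with
  | empty => simp [H.one_mem]
  | insert i s _ ih =>
    rw [Finset.gcd_insert]
    exact pow_gcd_mem (h i (Finset.mem_insert_self i s))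
      (ih fun j hj => h j (Finset.mem_insert_of_mem hj))

end Splitting

/-! ### Upper bound for determinants on the centralizer -/

section Centralizer

variable {F V : Type*} [Field F] [AddCommGroup V] [Module F V]
  {σ : F →+* F} {β : V →ₗ[F] V →ₛₗ[σ] F}

/-- The adjoint of `z - 1` is `z⁻¹ - 1 = -z⁻¹ (z - 1)`; placing `z ^ i` in the first argument avoids
the inverse. -/
theorem form_pow_sub_one {z : V ≃ₗ[F] V} (hz : ∀ u v, β (z u) (z v) = β u v) (i : ℕ) (u v : V) :
    β ((z ^ i) u) ((((z : Module.End F V) - 1) ^ i) v) =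
      (-1) ^ i * β ((((z : Module.End F V) - 1) ^ i) u) v := by
  set N : Module.End F V := (z : Module.End F V) - 1 with hN
  have hN' : ∀ w, N w = z w - w := fun w => rfl
  have hc : Commute (z : Module.End F V) N := (Commute.refl _).sub_right (Commute.one_right _)
  have h1 : ∀ a v, β (z a) (N v) = -β (N a) v := fun a v => by
    rw [hN', hN', map_sub, hz, map_sub, LinearMap.sub_apply]
    ring
  induction i generalizing u v with
  | zero => simp
  | succ i ih =>
    have h2 : (N ^ i) (z u) = z ((N ^ i) u) := (apply_comm (hc.pow_right i) u).symm
    rw [pow_succ, pow_succ N, LinearEquiv.mul_apply, Module.End.mul_apply, ih, h2, h1,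
      ← Module.End.mul_apply N, ← pow_succ' N, ← pow_succ N, pow_succ (-1 : F)]
    ring

theorem pow_sub_one_separating (hβ : β.SeparatingLeft) {z : V ≃ₗ[F] V}
    (hz : ∀ u v, β (z u) (z v) = β u v) (i : ℕ) (u : V) :
    (((z : Module.End F V) - 1) ^ i) u = 0 ↔
      ∀ v, β u ((((z : Module.End F V) - 1) ^ i) v) = 0 := by
  set N : Module.End F V := (z : Module.End F V) - 1 with hN
  have hc : Commute ((z ^ i : V ≃ₗ[F] V) : Module.End F V) (N ^ i) := by
    have : Commute (z : Module.End F V) N := (Commute.refl _).sub_right (Commute.one_right _)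
    have h3 : ((z ^ i : V ≃ₗ[F] V) : Module.End F V) = (z : Module.End F V) ^ i :=
      map_pow (LinearEquiv.automorphismGroup.toLinearMapMonoidHom) z i
    rw [h3]
    exact this.pow_pow i i
  obtain ⟨a, rfl⟩ := (z ^ i).surjective u
  have h4 : (N ^ i) ((z ^ i) a) = (z ^ i) ((N ^ i) a) := (apply_comm hc a).symm
  rw [h4, LinearEquiv.map_eq_zero_iff]
  constructor
  · intro h v
    rw [form_pow_sub_one hz, ← hN, h, map_zero, LinearMap.zero_apply, mul_zero]
  · intro h
    refine hβ _ fun v => ?_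
    have := h v
    rw [form_pow_sub_one hz] at this
    exact (mul_eq_zero.1 this).resolve_left (by simp)

variable [FiniteDimensional F V]

/-- The layer determinant is the quotient of the determinants on two consecutive kernels, each of
norm one. -/
theorem detOn_layer_mul_map (hβ : β.SeparatingLeft) {z : V ≃ₗ[F] V}
    (hz : ∀ u v, β (z u) (z v) = β u v) {y : Module.End F V}
    (hy : ∀ u v, β (y u) (y v) = β u v) (hc : Commute y ((z : Module.End F V) - 1)) (i : ℕ) :
    detOn y (LinearMap.ker ((z : Module.End F V) - 1) ⊓
        LinearMap.range (((z : Module.End F V) - 1) ^ i)) *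
      σ (detOn y (LinearMap.ker ((z : Module.End F V) - 1) ⊓
        LinearMap.range (((z : Module.End F V) - 1) ^ i))) = 1 := by
  have h1 := detOn_ker_mul_map hβ (pow_sub_one_separating hβ hz i) (hc.pow_right i) hy
  have h2 := detOn_ker_mul_map hβ (pow_sub_one_separating hβ hz (i + 1)) (hc.pow_right (i + 1)) hy
  rw [detOn_ker_pow_succ hc, map_mul, mul_mul_mul_comm, h1, one_mul] at h2
  exact h2

/-- Writing the order of `x` as `p ^ a * k` with `p ∤ k`, Frobenius gives `(X ^ k - 1) ^ (p ^ a) = X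
^ (p ^ a * k) - 1`. The condition on `k` makes `X ^ k - 1` separable. -/
theorem exists_pow_sub_one_nilpotent [Finite F] (x : V ≃ₗ[F] V) :
    ∃ k : ℕ, (k : F) ≠ 0 ∧ ∃ n, 0 < n ∧ (aeval (x : Module.End F V) (X ^ k - 1 : F[X])) ^ n = 0 := by
  have : Finite V := Module.finite_of_finite F
  have : Finite (V ≃ₗ[F] V) := DFunLike.finite _
  obtain ⟨p, hp⟩ := CharP.exists F
  have hp0 : Fact p.Prime := ⟨CharP.char_is_prime F p⟩
  obtain ⟨a, k, hk, hak⟩ := Nat.exists_eq_pow_mul_and_not_dvd (orderOf_pos x).ne' p hp0.out.ne_one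
  refine ⟨k, fun h => hk ((CharP.cast_eq_zero_iff F p k).1 h), p ^ a, pow_pos hp0.out.pos a, ?_⟩
  rw [← map_pow, sub_pow_char_pow, one_pow, ← pow_mul, mul_comm, ← hak, map_sub, map_pow, aeval_X,
    map_one, sub_eq_zero]
  have h3 : ((x ^ orderOf x : V ≃ₗ[F] V) : Module.End F V) = (x : Module.End F V) ^ orderOf x :=
    map_pow (LinearEquiv.automorphismGroup.toLinearMapMonoidHom) x _
  rw [← h3, pow_orderOf_eq_one]
  rfl

omit [FiniteDimensional F V] in
theorem aeval_X_pow_sub_one (x : V ≃ₗ[F] V) (k : ℕ) :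
    aeval (x : Module.End F V) (X ^ k - 1 : F[X]) =
      ((x ^ k : V ≃ₗ[F] V) : Module.End F V) - 1 := by
  have h3 : ((x ^ k : V ≃ₗ[F] V) : Module.End F V) = (x : Module.End F V) ^ k :=
    map_pow (LinearEquiv.automorphismGroup.toLinearMapMonoidHom) x _
  rw [h3, map_sub, map_pow, aeval_X, map_one]

omit [FiniteDimensional F V] in
theorem isometry_pow {x : V ≃ₗ[F] V} (hx : ∀ u v, β (x u) (x v) = β u v) (k : ℕ) (u v : V) :
    β ((x ^ k) u) ((x ^ k) v) = β u v := by
  induction k with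
  | zero => rfl
  | succ k ih => rw [pow_succ', LinearEquiv.mul_apply, LinearEquiv.mul_apply, hx, ih]

/-- The determinant of an isometry that commutes with the isometry `x` is the `d`-th power of an
element of norm one if `d` divides the exponents of all elementary divisors of `x`. -/
theorem exists_det_eq_pow [Finite F] (hβ : β.SeparatingLeft) {x y : V ≃ₗ[F] V}
    (hx : ∀ u v, β (x u) (x v) = β u v) (hy : ∀ u v, β (y u) (y v) = β u v)
    (hxy : Commute (y : Module.End F V) x) {d : ℕ} (hd0 : 0 < d)
    (hd : ∀ f m, IsElementaryDivisor (x : Module.End F V) f m → d ∣ m) :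
    ∃ δ : F, δ * σ δ = 1 ∧ LinearMap.det (y : Module.End F V) = δ ^ d := by
  obtain ⟨k, hk, n, hn, hkn⟩ := exists_pow_sub_one_nilpotent x
  have hblock : ∀ m, 0 < m → HasBlock (aeval (x : Module.End F V) (X ^ k - 1 : F[X])) m → d ∣ m :=
    fun m hm hb => by
      have hsq : Squarefree (X ^ k - 1 : F[X]) := by
        have := (separable_X_pow_sub_C (1 : F) hk one_ne_zero).squarefree
        rwa [map_one] at this
      obtain ⟨f, -, hf⟩ := exists_isElementaryDivisor_of_hasBlock hsq hm hb
      exact hd f m hf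
  have hc : Commute (y : Module.End F V) (aeval (x : Module.End F V) (X ^ k - 1 : F[X])) := by
    rw [map_sub, map_pow, aeval_X, map_one]
    exact (hxy.pow_right k).sub_right (Commute.one_right _)
  have h1 := detOn_ker_pow_mul hc hblock n
  have h2 : (aeval (x : Module.End F V) (X ^ k - 1 : F[X])) ^ (d * n) = 0 := by
    rw [mul_comm, pow_mul, hkn, zero_pow hd0.ne']
  rw [h2, LinearMap.ker_zero, detOn_top] at h1
  refine ⟨_, ?_, h1⟩
  rw [map_prod, ← Finset.prod_mul_distrib]
  rw [aeval_X_pow_sub_one] at hc ⊢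
  exact Finset.prod_eq_one fun j _ => detOn_layer_mul_map hβ (isometry_pow hx k) hy hc _

end Centralizer

/-! ### Upper bound in the orthogonal case -/

section OrthogonalCentralizer

variable {F V : Type*} [Field F] [AddCommGroup V] [Module F V]

theorem commute_of_inverse {R : Type*} [Monoid R] {a b b' : R} (h : b * b' = 1) (h' : b' * b = 1)
    (hab : Commute a b) : Commute a b' := by
  calc a * b' = b' * b * a * b' := by rw [h', one_mul]
    _ = b' * (a * b) * b' := by rw [mul_assoc b', ← hab.eq]
    _ = b' * a := by rw [mul_assoc, mul_assoc, h, mul_one]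

theorem detOn_eq_neg_one_pow [FiniteDimensional F V] {y : Module.End F V} {W : Submodule F V}
    (hi : ∀ w ∈ W, y w ∈ W) {n : ℕ} (h : ∀ w ∈ W, ((y + 1) ^ n) w = 0) :
    detOn y W = (-1) ^ Module.finrank F W := by
  rw [detOn_of_invariant hi]
  refine det_add_one_eq_of_nilpotent ⟨n, ?_⟩
  have key : ∀ (j : ℕ) (w : W), ((((y.restrict hi : Module.End F W) + 1) ^ j) w : V) =
      ((y + 1) ^ j) w := fun j => by
    induction j with
    | zero => exact fun w => rfl
    | succ j ih =>
      intro w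
      rw [pow_succ, pow_succ, Module.End.mul_apply, Module.End.mul_apply, ih]
      rfl
  ext w
  rw [key, h w w.2]
  rfl

theorem isElementaryDivisor_of_dvd {x : Module.End F V} {f : F[X]} {m : ℕ}
    (hf : IsElementaryDivisor x f m) (hdvd : f ∣ X ^ 2 - 1) : f = X - 1 ∨ f = X + 1 := by
  obtain ⟨hmon, hirr, -⟩ := hf.hasBlock
  have h1 : (X ^ 2 - 1 : F[X]) = (X - C 1) * (X - C (-1)) := by
    rw [map_neg, map_one]
    ring
  rw [h1] at hdvd
  rcases hirr.prime.dvd_or_dvd hdvd with h | h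
  · left
    rw [← map_one C]
    exact eq_of_monic_of_associated hmon (monic_X_sub_C 1)
      (hirr.associated_of_dvd (irreducible_X_sub_C 1) h)
  · right
    have := eq_of_monic_of_associated hmon (monic_X_sub_C (-1))
      (hirr.associated_of_dvd (irreducible_X_sub_C (-1)) h)
    rw [this, map_neg, map_one, sub_neg_eq_add]

variable [FiniteDimensional F V]

/-- On `range T` the map `y` preserves a non-degenerate alternating form. The self-adjoint `S = y +
y⁻¹ + 2` satisfies `y S = (y + 1) ^ 2`, so `S ^ l` separates the generalized eigenspace of `-1`, and
`S ^ l * T` is again skew-adjoint. Away from `-1` the determinant is `1`; on the eigenspace it is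
`-1` to an even power. -/
theorem detOn_range_of_skew {β : V →ₗ[F] V →ₗ[F] F} (h2 : (2 : F) ≠ 0) (hβ : β.SeparatingLeft)
    (hs : ∀ u v, β u v = β v u) {y : V ≃ₗ[F] V} (hy : ∀ u v, β (y u) (y v) = β u v)
    {T : Module.End F V} (hyT : Commute (y : Module.End F V) T)
    (hT : ∀ u v, β (T u) v = -β u (T v)) :
    detOn (y : Module.End F V) (LinearMap.range T) = 1 := by
  set Y : Module.End F V := (y : Module.End F V) with hY
  set Yi : Module.End F V := ((y⁻¹ : V ≃ₗ[F] V) : Module.End F V) with hYi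
  have h1 : Y * Yi = 1 := by ext u; exact y.apply_symm_apply u
  have h1' : Yi * Y = 1 := by ext u; exact y.symm_apply_apply u
  have hadj : ∀ u v, β (Y u) v = β u (Yi v) := fun u v => by
    rw [← hy u (Yi v)]
    exact congrArg _ (y.apply_symm_apply v).symm
  have hadj' : ∀ u v, β (Yi u) v = β u (Y v) := fun u v => by rw [hs, ← hadj, hs]
  have hYiT : Commute Yi T := (commute_of_inverse h1 h1' hyT.symm).symm
  have hcomm : Commute Y Yi := h1.trans h1'.symm
  set l := Module.finrank F V with hl
  set S : Module.End F V := Y + Yi + 2 with hS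
  have hYS : Commute Y S :=
    ((Commute.refl Y).add_right hcomm).add_right (Commute.ofNat_right Y 2)
  have hST : Commute S T := (hyT.add_left hYiT).add_left (Commute.ofNat_left 2 T)
  have hSY : Y * S = (Y + 1) ^ 2 := by
    rw [hS, mul_add, mul_add, h1, sq, add_mul, mul_add, one_mul, mul_one, mul_two]
    abel
  have hSadj : ∀ (i : ℕ) u v, β ((S ^ i) u) v = β u ((S ^ i) v) := by
    intro i
    induction i with
    | zero => exact fun u v => rfl
    | succ i ih =>
      intro u v
      have h3 : ∀ u v, β (S u) v = β u (S v) := fun u v => by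
        have h4 : ∀ w, S w = Y w + Yi w + (2 : F) • w := fun w => by
          rw [two_smul]
          simp only [hS, LinearMap.add_apply, Module.End.ofNat_apply]
          rw [two_smul ℕ]
        simp only [h4, map_add, LinearMap.add_apply, map_smul, LinearMap.smul_apply, hadj, hadj']
        ring
      rw [pow_succ', Module.End.mul_apply, h3, ih, ← Module.End.mul_apply, ← pow_succ,
        pow_succ']
  have hSTadj : ∀ u v, β ((S ^ l * T) u) v = -β u ((S ^ l * T) v) := fun u v => by
    rw [Module.End.mul_apply, hSadj, hT, ← Module.End.mul_apply, (hST.pow_left l).eq]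
  have hYST : Commute Y (S ^ l * T) := (hYS.pow_right l).mul_right hyT
  have hmap : (LinearMap.range T).map (S ^ l) = LinearMap.range (S ^ l * T) :=
    (LinearMap.range_comp T (S ^ l)).symm
  have heven1 := even_finrank_range_of_skew h2 hβ hs hT
  have heven2 := even_finrank_range_of_skew h2 hβ hs hSTadj
  have hneg : ∀ W : Submodule F V, detOn (-1 : Module.End F V) W = (-1) ^ Module.finrank F W :=
    fun W => detOn_eq_neg_one_pow (n := 1) (fun w hw => W.neg_mem hw) fun w hw => by simp
  -- The determinant of the scalar `-1` records parity of dimension: `range T` and `range (S ^ l *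
  -- T)` are even-dimensional, hence so is `range T ⊓ ker (S ^ l)`.
  have hcase := detOn_eq_ker_mul_map (y := (-1 : Module.End F V)) (T := S ^ l)
    (W := LinearMap.range T) (Commute.neg_one_left _) fun w hw => Submodule.neg_mem _ hw
  rw [hmap, hneg, hneg, hneg, heven1.neg_one_pow, heven2.neg_one_pow, mul_one] at hcase
  rw [detOn_eq_ker_mul_map (hYS.pow_right l) (invariant_range hyT), hmap,
    detOn_eq_neg_one_pow (n := 2 * l), ← hcase, one_mul]
  · refine detOn_range_eq_one (separating_of_adjoint (c := -1) (by simp) hβ (by simpa using hSTadj))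
      hYST hy ?_
    rintro _ ⟨w, rfl⟩ hw
    have h5 : S ((S ^ l * T) w) = 0 := by
      have h6 : Y (S ((S ^ l * T) w)) = 0 := by
        have h8 : (Y + 1) ((S ^ l * T) w) = 0 := hw
        rw [← Module.End.mul_apply, hSY, sq, Module.End.mul_apply, h8, map_zero]
      exact (LinearEquiv.map_eq_zero_iff y).1 h6
    have h7 : T w ∈ LinearMap.ker (S ^ (l + 1)) := by
      rw [LinearMap.mem_ker, pow_succ']
      exact h5
    -- Kernels of powers are stable from `l = dim V` on, so `S ^ (l + 1)` killing `T w` already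
    -- forces `S ^ l` to kill it.
    rw [Module.End.ker_pow_eq_ker_pow_finrank_of_le (Nat.le_succ l)] at h7
    exact h7
  · exact fun w hw => ⟨invariant_range hyT w hw.1, invariant_ker (hYS.pow_right l) w hw.2⟩
  · intro w hw
    rw [pow_mul, ← hSY, hYS.mul_pow, Module.End.mul_apply, LinearMap.mem_ker.1 hw.2, map_zero]

/-- An orthogonal transformation commuting with `x` has determinant `1` if `x` has no elementary
divisor `(X ∓ 1) ^ m` with `m` odd. -/
theorem det_eq_one_of_no_odd_divisor {β : V →ₗ[F] V →ₗ[F] F} (h2 : (2 : F) ≠ 0)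
    (hβ : β.SeparatingLeft) (hs : ∀ u v, β u v = β v u) {x y : V ≃ₗ[F] V}
    (hx : ∀ u v, β (x u) (x v) = β u v) (hy : ∀ u v, β (y u) (y v) = β u v)
    (hxy : Commute (y : Module.End F V) x)
    (hd : ∀ m : ℕ, Odd m → ¬ IsElementaryDivisor (x : Module.End F V) (X - 1) m ∧
      ¬ IsElementaryDivisor (x : Module.End F V) (X + 1) m) :
    LinearMap.det (y : Module.End F V) = 1 := by
  set N : Module.End F V := aeval (x : Module.End F V) (X ^ 2 - 1 : F[X]) with hN
  have hNx : N = ((x ^ 2 : V ≃ₗ[F] V) : Module.End F V) - 1 := aeval_X_pow_sub_one x 2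
  have hblock : ∀ m, 0 < m → HasBlock N m → 2 ∣ m := fun m hm hb => by
    have hsq : Squarefree (X ^ 2 - 1 : F[X]) := by
      have := (separable_X_pow_sub_C (n := 2) (1 : F) (by simpa using h2) one_ne_zero).squarefree
      rwa [map_one] at this
    obtain ⟨f, hf, hfm⟩ := exists_isElementaryDivisor_of_hasBlock hsq hm hb
    rw [← even_iff_two_dvd]
    by_contra hodd
    rw [Nat.not_even_iff_odd] at hodd
    rcases isElementaryDivisor_of_dvd hfm hf with rfl | rfl
    · exact (hd m hodd).1 hfm
    · exact (hd m hodd).2 hfm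
  set Xi : Module.End F V := ((x⁻¹ : V ≃ₗ[F] V) : Module.End F V) with hXi
  have h1 : (x : Module.End F V) * Xi = 1 := by ext u; exact x.apply_symm_apply u
  have h1' : Xi * (x : Module.End F V) = 1 := by ext u; exact x.symm_apply_apply u
  have hadj : ∀ u v, β (x u) v = β u (Xi v) := fun u v => by
    rw [← hx u (Xi v)]
    exact congrArg _ (x.apply_symm_apply v).symm
  have hadj' : ∀ u v, β (Xi u) v = β u (x v) := fun u v => by rw [hs, ← hadj, hs]
  have hyXi : Commute (y : Module.End F V) Xi := commute_of_inverse h1 h1' hxy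
  have hyN : Commute (y : Module.End F V) N := by
    rw [hN, map_sub, map_pow, aeval_X, map_one]
    exact (hxy.pow_right 2).sub_right (Commute.one_right _)
  set S : Module.End F V := (x : Module.End F V) - Xi with hS
  set l := Module.finrank F V with hl
  have hyS : Commute (y : Module.End F V) S := hxy.sub_right hyXi
  have hSN : S = Xi * N := by
    rw [hN, map_sub, map_pow, aeval_X, map_one, mul_sub, mul_one, sq, ← mul_assoc, h1', one_mul]
  have hXiN : Commute Xi N := by
    rw [hN, map_sub, map_pow, aeval_X, map_one]
    have : Commute Xi (x : Module.End F V) := h1'.trans h1.symm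
    exact (this.pow_right 2).sub_right (Commute.one_right _)
  have hSadj : ∀ (i : ℕ) u v, β ((S ^ i) u) v = (-1) ^ i * β u ((S ^ i) v) := by
    intro i
    induction i with
    | zero => exact fun u v => by simp
    | succ i ih =>
      intro u v
      have h3 : ∀ u v, β (S u) v = -β u (S v) := fun u v => by
        have h4 : ∀ w, S w = x w - Xi w := fun w => rfl
        rw [h4, h4, map_sub, map_sub, LinearMap.sub_apply, hadj, hadj']
        ring
      rw [pow_succ' S, Module.End.mul_apply, h3, ih, ← Module.End.mul_apply, ← pow_succ S,
        pow_succ' S, pow_succ' (-1 : F)]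
      ring
  -- The exponent of `S` is odd to keep it skew-adjoint, that of `N` is even to apply the layer
  -- formula with `d = 2`. The kernels agree because `S = x⁻¹ N` and both exponents are past the
  -- point of stabilization.
  have hker : LinearMap.ker (S ^ (2 * l + 1)) = LinearMap.ker (N ^ (2 * l)) := by
    have h5 : LinearMap.ker (N ^ (2 * l + 1)) = LinearMap.ker (N ^ (2 * l)) := by
      rw [Module.End.ker_pow_eq_ker_pow_finrank_of_le (by omega : l ≤ 2 * l + 1),
        Module.End.ker_pow_eq_ker_pow_finrank_of_le (by omega : l ≤ 2 * l)]
    rw [← h5, hSN, hXiN.mul_pow]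
    refine LinearMap.ker_comp_of_ker_eq_bot _ ?_
    have h6 : Xi ^ (2 * l + 1) = (((x⁻¹) ^ (2 * l + 1) : V ≃ₗ[F] V) : Module.End F V) :=
      (map_pow (LinearEquiv.automorphismGroup.toLinearMapMonoidHom) x⁻¹ _).symm
    rw [h6]
    exact LinearEquiv.ker _
  rw [det_eq_ker_mul_range (hyS.pow_right (2 * l + 1)), hker, detOn_ker_pow_mul hyN hblock,
    detOn_range_of_skew h2 hβ hs hy (hyS.pow_right (2 * l + 1)), mul_one, sq,
    ← Finset.prod_mul_distrib]
  · rw [hNx] at hyN ⊢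
    exact Finset.prod_eq_one fun j _ =>
      detOn_layer_mul_map (σ := RingHom.id F) hβ (isometry_pow hx 2) hy hyN _
  · intro u v
    rw [hSadj, Odd.neg_one_pow ⟨l, rfl⟩, neg_one_mul]

end OrthogonalCentralizer

/-! ### Reversal of polynomials and divisibility by prime powers -/

section Polynomials

variable {F : Type*} [Field F]

/-- The ideals of `F[X] / (f ^ m)` form a chain, so every nonzero one contains the smallest,
generated by `f ^ (m - 1)`. -/
theorem exists_dvd_mul_sub {f p : F[X]} (hf : Irreducible f) {m : ℕ} (h : ¬ f ^ m ∣ p) :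
    ∃ r, f ^ m ∣ r * p - f ^ (m - 1) := by
  classical
  obtain ⟨j, hj, hass⟩ := (dvd_prime_pow hf.prime m).1 (EuclideanDomain.gcd_dvd_right p (f ^ m))
  have hjm : j < m := lt_of_le_of_ne hj fun h0 => h <| by
    rw [← h0]
    exact hass.symm.dvd.trans (EuclideanDomain.gcd_dvd_left p (f ^ m))
  obtain ⟨c, hc⟩ := hass.dvd
  have hb := EuclideanDomain.gcd_eq_gcd_ab p (f ^ m)
  refine ⟨EuclideanDomain.gcdA p (f ^ m) * c * f ^ (m - 1 - j),
    -(EuclideanDomain.gcdB p (f ^ m) * c * f ^ (m - 1 - j)), ?_⟩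
  have h1 : f ^ (m - 1) = f ^ (m - 1 - j) * f ^ j := by rw [← pow_add]; congr 1; omega
  rw [h1, hc]
  linear_combination (-c * f ^ (m - 1 - j)) * hb

theorem reverse_reverse_of_coeff_zero {g : F[X]} (hg : g.coeff 0 ≠ 0) :
    g.reverse.reverse = g := by
  have h1 : g.natTrailingDegree = 0 := natTrailingDegree_eq_zero.2 (Or.inr hg)
  rw [reverse, reverse_natDegree, h1, Nat.sub_zero, reverse, reflect_reflect]

theorem irreducible_reverse {f : F[X]} (hf : Irreducible f) (h0 : f.coeff 0 ≠ 0) :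
    Irreducible f.reverse := by
  have hunit : ∀ g : F[X], g.coeff 0 ≠ 0 → IsUnit g.reverse → IsUnit g := fun g hg hu => by
    have h1 : g.natTrailingDegree = 0 := natTrailingDegree_eq_zero.2 (Or.inr hg)
    have h2 := natDegree_eq_zero_of_isUnit hu
    rw [reverse_natDegree, h1, Nat.sub_zero] at h2
    rw [eq_C_of_natDegree_eq_zero h2]
    exact isUnit_C.2 (isUnit_iff_ne_zero.2 hg)
  constructor
  · intro hu
    exact hf.not_isUnit (hunit f h0 hu)
  · intro a b hab
    have h1 : f = a.reverse * b.reverse := by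
      rw [← reverse_reverse_of_coeff_zero h0, hab, reverse_mul_of_domain]
    have h2 : a.coeff 0 * b.coeff 0 ≠ 0 := by
      rw [← mul_coeff_zero, ← hab, coeff_zero_reverse]
      exact leadingCoeff_ne_zero.2 hf.ne_zero
    rcases hf.isUnit_or_isUnit h1 with h | h
    · exact Or.inl (hunit a (left_ne_zero_of_mul h2) h)
    · exact Or.inr (hunit b (right_ne_zero_of_mul h2) h)

theorem aeval_inverse_mul_pow {R : Type*} [Ring R] [Algebra F R] {a b : R} (h : b * a = 1) {d : ℕ}
    (g : F[X]) (hg : g.natDegree ≤ d) : aeval b g * a ^ d = aeval a (reflect d g) := by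
  refine induction_with_natDegree_le (fun g => aeval b g * a ^ d = aeval a (reflect d g)) d
    ?_ ?_ ?_ g hg
  · simp
  · intro n c _ hn
    have h1 : b ^ n * a ^ n = 1 := by
      clear hn
      induction n with
      | zero => simp
      | succ n ih => rw [pow_succ, pow_succ', mul_assoc, ← mul_assoc b, h, one_mul, ih]
    rw [reflect_C_mul_X_pow, revAt_le hn, map_mul, map_mul, aeval_C, aeval_C, map_pow, map_pow,
      aeval_X, aeval_X, mul_assoc]
    congr 1
    obtain ⟨t, rfl⟩ := Nat.exists_eq_add_of_le hn
    rw [pow_add, ← mul_assoc, h1, one_mul, Nat.add_sub_cancel_left]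
  · intro p q _ _ hp hq
    rw [map_add, add_mul, hp, hq, reflect_add, map_add]

theorem commute_aeval {R : Type*} [Ring R] [Algebra F R] {a b : R} (h : Commute a b) (q : F[X]) :
    Commute a (aeval b q) := by
  induction q using Polynomial.induction_on' with
  | add p q hp hq => rw [map_add]; exact hp.add_right hq
  | monomial n c =>
    rw [aeval_monomial]
    exact (Algebra.commute_algebraMap_right c a).mul_right (h.pow_right n)

end Polynomials

/-! ### Determinants on cyclic submodules -/

section Cyclic

variable {F V : Type*} [Field F] [AddCommGroup V] [Module F V]

/-- The cyclic `F[X]`-submodule generated by `v`, where `X` acts as `x`. -/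
noncomputable def cyc (x : Module.End F V) (v : V) : Submodule F V :=
  LinearMap.range ((LinearMap.applyₗ v).comp (aeval x : F[X] →ₐ[F] Module.End F V).toLinearMap)

variable {x : Module.End F V} {v : V}

theorem mem_cyc {z : V} : z ∈ cyc x v ↔ ∃ p : F[X], aeval x p v = z := Iff.rfl

theorem self_mem_cyc : v ∈ cyc x v := mem_cyc.2 ⟨1, by simp⟩

theorem aeval_mem_cyc (p : F[X]) {z : V} (hz : z ∈ cyc x v) : aeval x p z ∈ cyc x v := by
  obtain ⟨q, rfl⟩ := mem_cyc.1 hz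
  exact mem_cyc.2 ⟨p * q, by rw [map_mul]; rfl⟩

theorem aeval_mul_apply (p q : F[X]) (z : V) : aeval x (p * q) z = aeval x p (aeval x q z) := by
  rw [map_mul]; rfl

theorem aeval_apply_eq_zero_iff {f : F[X]} (hf : Irreducible f) {m : ℕ}
    (hv : aeval x (f ^ m) v = 0) (hv' : aeval x (f ^ (m - 1)) v ≠ 0) {p : F[X]} :
    aeval x p v = 0 ↔ f ^ m ∣ p := by
  constructor
  · intro h
    by_contra hdvd
    obtain ⟨r, s, hr⟩ := exists_dvd_mul_sub hf hdvd
    apply hv'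
    have h1 : f ^ (m - 1) = r * p - s * f ^ m := by linear_combination -hr
    rw [h1, map_sub, LinearMap.sub_apply, aeval_mul_apply, aeval_mul_apply, h, hv, map_zero,
      map_zero, sub_zero]
  · rintro ⟨q, rfl⟩
    rw [mul_comm, aeval_mul_apply, hv, map_zero]

theorem eq_zero_of_isCoprime {f g : F[X]} (h : IsCoprime f g) {z : V} (hf : aeval x f z = 0)
    (hg : aeval x g z = 0) : z = 0 := by
  obtain ⟨a, b, hab⟩ := h
  have := congrArg (fun p => aeval x p z) hab
  simp only [map_add, LinearMap.add_apply, aeval_mul_apply, hf, hg, map_zero, map_one,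
    add_zero] at this
  exact this.symm

/-- The map is `p(x)` on the cyclic module, isomorphic to `F[X] / (f ^ m)`, and the identity on the
complement `ker e`. The `m` factors of the `f`-adic filtration are copies of `F[X] / (f)`, on each
of which the determinant is the norm of `p`. The layer formula is reused for `N`, which is `f(x)` on
the cyclic module and `1` on the complement. -/
theorem det_on_cyclic [FiniteDimensional F V] {f : F[X]} [Fact (Irreducible f)] {m : ℕ}
    (hm : 0 < m) {e : Module.End F V} (hex : Commute e x) (he : ∀ z, e z ∈ cyc x v) (hev : e v = v)
    (hv : aeval x (f ^ m) v = 0) (hv' : aeval x (f ^ (m - 1)) v ≠ 0) (p : F[X]) :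
    LinearMap.det (1 + (aeval x p - 1) * e) =
      Algebra.norm F (AdjoinRoot.mk f p) ^ m := by
  have hf : Irreducible f := Fact.out
  have hcp : ∀ q : F[X], Commute e (aeval x q) := fun q =>
    commute_aeval hex q
  have hecyc : ∀ z ∈ cyc x v, e z = z := fun z hz => by
    obtain ⟨q, rfl⟩ := mem_cyc.1 hz
    rw [apply_comm (hcp q), hev]
  have hee : e * e = e := by ext z; exact hecyc _ (he z)
  set N : Module.End F V := aeval x f * e + (1 - e) with hN
  set B : Module.End F V := 1 + (aeval x p - 1) * e with hB
  have hNpow : ∀ i, N ^ i = aeval x (f ^ i) * e + (1 - e) := fun i => by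
    induction i with
    | zero => rw [pow_zero, pow_zero, map_one]; noncomm_ring
    | succ i ih =>
      have h1 : (1 - e) * aeval x f * e = 0 := by
        rw [mul_assoc, ← (hcp f).eq, ← mul_assoc, sub_mul, hee, one_mul, sub_self, zero_mul]
      have h2 : (1 - e) * (1 - e) = 1 - e := by
        rw [mul_sub, sub_mul, sub_mul, hee, mul_one, mul_one, one_mul, sub_self, sub_zero]
      have h3 : e * (1 - e) = 0 := by rw [mul_sub, hee, mul_one, sub_self]
      rw [pow_succ, ih, hN, add_mul, mul_add, mul_add, h2, ← mul_assoc (1 - e), h1,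
        mul_assoc _ e (1 - e), h3, mul_zero, zero_add, add_zero, pow_succ, map_mul,
        mul_assoc (aeval x (f ^ i)) e, ← mul_assoc e, (hcp f).eq, mul_assoc (aeval x f) e e, hee,
        mul_assoc]
  have hfe : aeval x (f ^ m) * e = 0 := by
    ext z
    obtain ⟨q, hq⟩ := mem_cyc.1 (he z)
    rw [Module.End.mul_apply, ← hq, ← aeval_mul_apply, mul_comm, aeval_mul_apply, hv, map_zero]
    rfl
  have hNm : N ^ m = 1 - e := by rw [hNpow, hfe, zero_add]
  have hkerN : ∀ i u, (N ^ i) u = 0 ↔ e u = u ∧ aeval x (f ^ i) u = 0 := fun i u => by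
    rw [hNpow]
    constructor
    · intro h
      have h1 : aeval x (f ^ i) (e u) + (u - e u) = 0 := h
      have h2 := congrArg e h1
      have h3 : e (e u) = e u := LinearMap.congr_fun hee u
      rw [map_add, map_zero, map_sub, apply_comm (hcp _), h3, sub_self, add_zero] at h2
      rw [h2, zero_add, sub_eq_zero] at h1
      exact ⟨h1.symm, by rw [h1]; exact h2⟩
    · rintro ⟨h1, h2⟩
      change aeval x (f ^ i) (e u) + (u - e u) = 0
      rw [h1, h2, sub_self, add_zero]
  have hBN : Commute B N := by
    have hpq : Commute (aeval x p) (aeval x f) := by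
      change aeval x p * aeval x f = aeval x f * aeval x p
      rw [← map_mul, mul_comm, map_mul]
    have h1 : Commute B (aeval x f) :=
      (Commute.one_left _).add_left ((hpq.sub_left (Commute.one_left _)).mul_left (hcp f))
    have h2 : Commute B e := (Commute.one_left _).add_left
      (((hcp p).symm.sub_left (Commute.one_left _)).mul_left (Commute.refl _))
    exact (h1.mul_right h2).add_right ((Commute.one_right _).sub_right h2)
  -- For `i < m`, a vector killed by `f ^ i` in the cyclic module is a multiple of `f`; for `i > m`
  -- the powers of `N` are already constant. Only `i = m` remains.
  have hblock : ∀ i, 0 < i → HasBlock N i → m ∣ i := by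
    rintro i hi ⟨u, hu, hu'⟩
    rcases lt_trichotomy i m with h | h | h
    · obtain ⟨h1, h2⟩ := (hkerN i u).1 hu
      obtain ⟨q, hq⟩ := mem_cyc.1 (h1 ▸ he u)
      rw [← hq, ← aeval_mul_apply, aeval_apply_eq_zero_iff hf hv hv'] at h2
      obtain ⟨t, rfl⟩ : ∃ t, m = i + (t + 1) := ⟨m - i - 1, by omega⟩
      rw [pow_add, mul_dvd_mul_iff_left (pow_ne_zero _ hf.ne_zero), pow_succ'] at h2
      obtain ⟨s, hs⟩ := h2
      refine absurd ⟨aeval x (f ^ t * s) v, ?_⟩ hu'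
      obtain ⟨i, rfl⟩ : ∃ j, i = j + 1 := ⟨i - 1, by omega⟩
      have h4 : N (aeval x (f ^ t * s) v) = u := by
        have h5 := hecyc _ (mem_cyc.2 ⟨f ^ t * s, rfl⟩)
        change aeval x f (e (aeval x (f ^ t * s) v)) +
          (aeval x (f ^ t * s) v - e (aeval x (f ^ t * s) v)) = u
        rw [h5, sub_self, add_zero, ← aeval_mul_apply, ← mul_assoc, ← hs, hq]
      rw [pow_succ, Module.End.mul_apply, h4, Nat.add_sub_cancel]
    · exact h ▸ dvd_rfl
    · have h3 : ∀ j, m ≤ j → N ^ j = 1 - e := fun j hj => by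
        rw [hNpow, ← Nat.add_sub_of_le hj, pow_add, mul_comm, map_mul, mul_assoc, hfe, mul_zero,
          zero_add]
      rw [(h3 (i - 1) (by omega)).trans (h3 i (by omega)).symm, hu] at hu'
      exact absurd (Submodule.zero_mem _) hu'
  rw [det_eq_ker_mul_range (hBN.pow_right m)]
  have hrange : detOn B (LinearMap.range (N ^ m)) = 1 := by
    refine detOn_eq_one ?_
    rintro _ ⟨z, rfl⟩
    have h3 : e * (1 - e) = 0 := by rw [mul_sub, hee, mul_one, sub_self]
    rw [hNm, ← Module.End.mul_apply, hB, add_mul, mul_assoc, h3, mul_zero, one_mul, add_zero]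
  have hker := detOn_ker_pow_mul hBN hblock 1
  rw [Finset.prod_range_one, mul_one, mul_zero, pow_zero] at hker
  rw [hrange, mul_one, hker]
  congr 1
  have htop : LinearMap.ker N ⊓ LinearMap.range (1 : Module.End F V) = LinearMap.ker N := by
    rw [inf_eq_left]
    exact fun z _ => ⟨z, rfl⟩
  rw [htop, detOn_of_invariant (invariant_ker hBN), Algebra.norm_apply]
  have hkerN1 : ∀ u, u ∈ LinearMap.ker N ↔ e u = u ∧ aeval x f u = 0 := fun u => by
    have := hkerN 1 u
    rwa [pow_one, pow_one] at this
  have hmem : ∀ q : F[X], aeval x (q * f ^ (m - 1)) v ∈ LinearMap.ker N := fun q => by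
    rw [hkerN1]
    refine ⟨hecyc _ (mem_cyc.2 ⟨_, rfl⟩), ?_⟩
    rw [← aeval_mul_apply, aeval_apply_eq_zero_iff hf hv hv']
    refine ⟨q, ?_⟩
    have : f ^ m = f ^ (m - 1) * f := by rw [← pow_succ]; congr 1; omega
    rw [this]
    ring
  -- `ker N` is the socle of the cyclic module, and `q ↦ q f ^ (m - 1) v` identifies it with `F[X] /
  -- (f)`.
  let g : F[X] →ₗ[F] LinearMap.ker N :=
    (((LinearMap.applyₗ v).comp (aeval x : F[X] →ₐ[F] Module.End F V).toLinearMap).comp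
      (LinearMap.mulRight F (f ^ (m - 1)))).codRestrict _ hmem
  have hg : Function.Surjective g := by
    rintro ⟨u, hu⟩
    obtain ⟨h1, h2⟩ := (hkerN1 u).1 hu
    obtain ⟨q, hq⟩ := mem_cyc.1 (h1 ▸ he u)
    rw [← hq, ← aeval_mul_apply, aeval_apply_eq_zero_iff hf hv hv'] at h2
    have : f ^ m = f * f ^ (m - 1) := by rw [← pow_succ']; congr 1; omega
    rw [this, mul_dvd_mul_iff_left hf.ne_zero] at h2
    obtain ⟨s, hs⟩ := h2
    refine ⟨s, Subtype.ext ?_⟩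
    change aeval x (s * f ^ (m - 1)) v = u
    rw [mul_comm, ← hs, hq]
  let a : F[X] →ₗ[F] AdjoinRoot f := (AdjoinRoot.mkₐ f).toLinearMap
  have ha : Function.Surjective a := AdjoinRoot.mk_surjective
  have hag : LinearMap.ker g = LinearMap.ker a := by
    ext q
    have h1 : a q = AdjoinRoot.mk f q := rfl
    rw [LinearMap.mem_ker, LinearMap.mem_ker, h1, AdjoinRoot.mk_eq_zero]
    have h2 : g q = 0 ↔ aeval x (q * f ^ (m - 1)) v = 0 := Subtype.ext_iff
    rw [h2, aeval_apply_eq_zero_iff hf hv hv']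
    have : f ^ m = f * f ^ (m - 1) := by rw [← pow_succ']; congr 1; omega
    rw [this, mul_dvd_mul_iff_right (pow_ne_zero _ hf.ne_zero)]
  refine det_eq_det_of_semiconj ((g.quotKerEquivOfSurjective hg).symm.trans
    ((Submodule.quotEquivOfEq _ _ hag).trans (a.quotKerEquivOfSurjective ha))) fun u => ?_
  obtain ⟨q, rfl⟩ := hg u
  have h1 : ∀ q, ((g.quotKerEquivOfSurjective hg).symm.trans
    ((Submodule.quotEquivOfEq _ _ hag).trans (a.quotKerEquivOfSurjective ha))) (g q) = a q := by
    intro q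
    have h2 : (g.quotKerEquivOfSurjective hg).symm (g q) = Submodule.Quotient.mk q := by
      rw [LinearEquiv.symm_apply_eq]; rfl
    rw [LinearEquiv.trans_apply, h2]
    rfl
  have h3 : (B.restrict (invariant_ker hBN)) (g q) = g (p * q) := by
    refine Subtype.ext ?_
    change aeval x (q * f ^ (m - 1)) v + (aeval x p (e (aeval x (q * f ^ (m - 1)) v)) -
      e (aeval x (q * f ^ (m - 1)) v)) = aeval x (p * q * f ^ (m - 1)) v
    rw [hecyc _ (mem_cyc.2 ⟨_, rfl⟩), add_sub_cancel, ← aeval_mul_apply, mul_assoc]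
  rw [h3, h1, h1]
  change AdjoinRoot.mk f (p * q) = AdjoinRoot.mk f p * AdjoinRoot.mk f q
  rw [map_mul]

end Cyclic

/-! ### Adjoints and projections from perfect pairings -/

section Construction

variable {F V : Type*} [Field F] [AddCommGroup V] [Module F V]
  {σ : F →+* F} {β : V →ₗ[F] V →ₛₗ[σ] F}

theorem apply_map_aeval {a b : Module.End F V} (h : ∀ u v, β (a u) v = β u (b v))
    (hσ : ∀ c, σ (σ c) = c) (p : F[X]) (u v : V) :
    β (aeval a p u) v = β u (aeval b (p.map σ) v) := by
  induction p using Polynomial.induction_on' generalizing u v with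
  | add p q hp hq =>
    simp only [map_add, LinearMap.add_apply, hp, hq, Polynomial.map_add]
  | monomial n c =>
    have h1 : ∀ u v, β ((a ^ n) u) v = β u ((b ^ n) v) := by
      induction n with
      | zero => exact fun u v => rfl
      | succ n ih =>
        intro u v
        rw [pow_succ, Module.End.mul_apply, ih, h, pow_succ', Module.End.mul_apply]
    rw [map_monomial, aeval_monomial, aeval_monomial, Module.End.mul_apply, Module.End.mul_apply,
      Module.algebraMap_end_apply, Module.algebraMap_end_apply, map_smul, LinearMap.smul_apply,
      map_smulₛₗ, hσ, h1]

variable [Finite F] [FiniteDimensional F V]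

/-- The additive map from `V` to its dual given by `β` is injective, hence bijective by counting. -/
theorem exists_form_eq (hβ : β.SeparatingRight) (φ : V →ₗ[F] F) : ∃ w, ∀ u, β u w = φ u := by
  have : Finite V := Module.finite_of_finite F
  let ψ : V → Module.Dual F V := fun w => β.flip w
  have hψ : Function.Injective ψ := fun w w' h => by
    rw [← sub_eq_zero]
    refine hβ _ fun u => ?_
    rw [map_sub, sub_eq_zero]
    exact LinearMap.congr_fun h u
  have hcard : Nat.card V = Nat.card (Module.Dual F V) :=
    Nat.card_congr (LinearEquiv.ofFinrankEq V _ (Subspace.dual_finrank_eq (K := F)).symm).toEquiv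
  have : Finite (Module.Dual F V) := Module.finite_of_finite F
  obtain ⟨w, hw⟩ := ((Nat.bijective_iff_injective_and_card ψ).2 ⟨hψ, hcard⟩).2 φ
  exact ⟨w, fun u => LinearMap.congr_fun hw u⟩

/-- The functional `β · w` vanishes on `ker T`, so it factors as `φ ∘ T`; representing `φ` by `w'`
gives `w = T' w'`. -/
theorem mem_range_of_orthogonal_ker (hβ : β.SeparatingRight) {T T' : Module.End F V}
    (hT : ∀ u v, β (T u) v = β u (T' v)) {w : V} (hw : ∀ u, T u = 0 → β u w = 0) :
    w ∈ LinearMap.range T' := by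
  have h1 : (β.flip w : V →ₗ[F] F) ∈ LinearMap.range T.dualMap := by
    rw [LinearMap.range_dualMap_eq_dualAnnihilator_ker, Submodule.mem_dualAnnihilator]
    exact fun u hu => hw u hu
  obtain ⟨φ, hφ⟩ := h1
  obtain ⟨w', hw'⟩ := exists_form_eq hβ φ
  refine ⟨w', ?_⟩
  rw [← sub_eq_zero]
  refine hβ _ fun u => ?_
  rw [map_sub, ← hT, hw', sub_eq_zero]
  exact LinearMap.congr_fun hφ u

omit [Finite F] in
theorem card_dual (K : Submodule F V) : Nat.card (Module.Dual F K) = Nat.card K :=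
  Nat.card_congr (LinearEquiv.ofFinrankEq _ K (Subspace.dual_finrank_eq (K := F))).toEquiv

/-- Non-degeneracy on both sides embeds `L` in the dual of `K` and `K` in the dual of `L`. Counting
makes the pairing perfect, and `e z` is the element of `L` representing `β · z` on `K`. -/
theorem exists_projection (hs : IsHermitianForm β) {K L : Submodule F V}
    (hK : ∀ a ∈ K, (∀ b ∈ L, β a b = 0) → a = 0) (hL : ∀ b ∈ L, (∀ a ∈ K, β a b = 0) → b = 0) :
    ∃ e : Module.End F V, (∀ z, e z ∈ L) ∧ ∀ z, ∀ a ∈ K, β a (e z) = β a z := by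
  have : Finite V := Module.finite_of_finite F
  let res : ∀ M : Submodule F V, V → Module.Dual F M := fun M z => (β.flip z).comp M.subtype
  have hinj : ∀ M M' : Submodule F V, (∀ b ∈ M', (∀ a ∈ M, β a b = 0) → b = 0) →
      Function.Injective fun b : M' => res M b := fun M M' h b b' hb => by
    refine Subtype.ext (sub_eq_zero.1 (h _ (M'.sub_mem b.2 b'.2) fun a ha => ?_))
    rw [map_sub, sub_eq_zero]
    exact LinearMap.congr_fun hb ⟨a, ha⟩
  have : ∀ M : Submodule F V, Finite (Module.Dual F M) := fun M => Module.finite_of_finite F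
  have h1 := Nat.card_le_card_of_injective _ (hinj K L hL)
  have h2 := Nat.card_le_card_of_injective _ (hinj L K fun b hb h => hK b hb fun a ha => by
    rw [hs, h a ha, map_zero])
  rw [card_dual] at h1 h2
  have hbij := (Nat.bijective_iff_injective_and_card _).2
    ⟨hinj K L hL, by rw [card_dual]; exact le_antisymm h1 h2⟩
  have hex : ∀ z, ∃ b ∈ L, ∀ a ∈ K, β a b = β a z := fun z => by
    obtain ⟨b, hb⟩ := hbij.2 (res K z)
    exact ⟨b, b.2, fun a ha => LinearMap.congr_fun hb ⟨a, ha⟩⟩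
  choose e he he' using hex
  have huniq : ∀ b ∈ L, ∀ b' ∈ L, (∀ a ∈ K, β a b = β a b') → b = b' := fun b hb b' hb' h =>
    sub_eq_zero.1 (hL _ (L.sub_mem hb hb') fun a ha => by rw [map_sub, h a ha, sub_self])
  refine ⟨⟨⟨e, fun z z' => ?_⟩, fun c z => ?_⟩, he, he'⟩
  · exact huniq _ (he _) _ (L.add_mem (he _) (he _)) fun a ha => by
      rw [he' _ a ha, map_add, map_add, he' _ a ha, he' _ a ha]
  · exact huniq _ (he _) _ (L.smul_mem _ (he _)) fun a ha => by
      rw [he' _ a ha, map_smulₛₗ, RingHom.id_apply, map_smulₛₗ, he' _ a ha]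

end Construction

/-! ### Inverses as polynomials in a map of finite order -/

section Inverse

variable {F V : Type*} [Field F] [Finite F] [AddCommGroup V] [Module F V] [FiniteDimensional F V]
  {x : V ≃ₗ[F] V}

theorem inverse_eq_pow (x : V ≃ₗ[F] V) :
    ((x⁻¹ : V ≃ₗ[F] V) : Module.End F V) = aeval (x : Module.End F V) (X ^ (orderOf x - 1) : F[X]) := by
  have : Finite V := Module.finite_of_finite F
  have : Finite (V ≃ₗ[F] V) := DFunLike.finite _
  have h1 : x⁻¹ = x ^ (orderOf x - 1) := by
    rw [inv_eq_iff_mul_eq_one, ← pow_succ', Nat.sub_add_cancel (orderOf_pos x), pow_orderOf_eq_one]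
  rw [map_pow, aeval_X, h1]
  exact map_pow (LinearEquiv.automorphismGroup.toLinearMapMonoidHom) x _

theorem aeval_inverse_mem_cyc {v z : V} (p : F[X]) (hz : z ∈ cyc (x : Module.End F V) v) :
    aeval ((x⁻¹ : V ≃ₗ[F] V) : Module.End F V) p z ∈ cyc (x : Module.End F V) v := by
  rw [inverse_eq_pow, ← aeval_comp]
  exact aeval_mem_cyc _ hz

end Inverse

/-! ### Pairings of cyclic submodules -/

section CyclicForms

variable {F V : Type*} [Field F] [Finite F] [AddCommGroup V] [Module F V] [FiniteDimensional F V]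
  {σ : F →+* F} {β : V →ₗ[F] V →ₛₗ[σ] F} {x : V ≃ₗ[F] V}

omit [Finite F] [FiniteDimensional F V] in
theorem isometry_adjoint (hx : ∀ u v, β (x u) (x v) = β u v) (u v : V) :
    β (x u) v = β u ((x⁻¹ : V ≃ₗ[F] V) v) := by
  rw [← hx u ((x⁻¹ : V ≃ₗ[F] V) v)]
  exact congrArg _ (x.apply_symm_apply v).symm

/-- If `a ≠ 0`, some polynomial in `x` sends it to the socle generator `f ^ (m - 1) v`. Its adjoint
preserves the cyclic module of `w`, so the socle generator would be orthogonal to that module as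
well. -/
theorem eq_zero_of_orthogonal_cyc (hσ : ∀ c, σ (σ c) = c) (hx : ∀ u v, β (x u) (x v) = β u v)
    {f : F[X]} (hf : Irreducible f) {m : ℕ} {v w : V}
    (hv : aeval (x : Module.End F V) (f ^ m) v = 0)
    (hvw : ∃ b ∈ cyc (x : Module.End F V) w, β (aeval (x : Module.End F V) (f ^ (m - 1)) v) b ≠ 0)
    {a : V} (ha : a ∈ cyc (x : Module.End F V) v)
    (hab : ∀ b ∈ cyc (x : Module.End F V) w, β a b = 0) : a = 0 := by
  obtain ⟨p, rfl⟩ := mem_cyc.1 ha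
  obtain ⟨b, hb, hvb⟩ := hvw
  by_contra h0
  have hdvd : ¬ f ^ m ∣ p := by
    rintro ⟨q, rfl⟩
    rw [mul_comm, aeval_mul_apply, hv, map_zero] at h0
    exact h0 rfl
  obtain ⟨r, s, hr⟩ := exists_dvd_mul_sub hf hdvd
  have h1 : f ^ (m - 1) = r * p - s * f ^ m := by linear_combination -hr
  apply hvb
  rw [h1, map_sub, LinearMap.sub_apply, aeval_mul_apply, aeval_mul_apply, hv, map_zero, sub_zero,
    apply_map_aeval (isometry_adjoint hx) hσ]
  exact hab _ (aeval_inverse_mem_cyc _ hb)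

omit [Finite F] [FiniteDimensional F V] in
/-- The adjoint of `f(x)` is `f'(x)` up to a power of `x`, where `f'` is the reverse of the
conjugate of `f`. -/
theorem aeval_map_inverse_mul_pow (f : F[X]) :
    aeval ((x⁻¹ : V ≃ₗ[F] V) : Module.End F V) (f.map σ) *
      (x : Module.End F V) ^ (f.map σ).natDegree = aeval (x : Module.End F V) (f.map σ).reverse :=
  aeval_inverse_mul_pow (by ext u; exact x.symm_apply_apply u) _ le_rfl

omit [Finite F] [FiniteDimensional F V] in
theorem form_aeval (hσ : ∀ c, σ (σ c) = c) (hx : ∀ u v, β (x u) (x v) = β u v) (f : F[X])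
    (u v : V) : β (aeval (x : Module.End F V) f u) v =
      β (((x : Module.End F V) ^ (f.map σ).natDegree) u)
        (aeval (x : Module.End F V) (f.map σ).reverse v) := by
  have h1 : ∀ (n : ℕ) (z : V), ((x : Module.End F V) ^ n) z = (x ^ n) z := fun n z =>
    LinearMap.congr_fun (map_pow (LinearEquiv.automorphismGroup.toLinearMapMonoidHom) x n).symm z
  have h2 : Commute ((x : Module.End F V) ^ (f.map σ).natDegree)
      (aeval ((x⁻¹ : V ≃ₗ[F] V) : Module.End F V) (f.map σ)) := by
    refine (commute_aeval ?_ _).pow_left _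
    have h3 : (x : Module.End F V) * ((x⁻¹ : V ≃ₗ[F] V) : Module.End F V) = 1 := by
      ext u; exact x.apply_symm_apply u
    have h4 : ((x⁻¹ : V ≃ₗ[F] V) : Module.End F V) * (x : Module.End F V) = 1 := by
      ext u; exact x.symm_apply_apply u
    exact h3.trans h4.symm
  rw [← aeval_map_inverse_mul_pow, ← h2.eq, Module.End.mul_apply, h1, h1, isometry_pow hx]
  exact apply_map_aeval (isometry_adjoint hx) hσ f u v

end CyclicForms

/-! ### The conjugate reverse of a polynomial -/

section ConjReverse

variable {F : Type*} [Field F]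

/-- The reverse of the conjugate of a polynomial. -/
noncomputable def conjReverse (σ : F →+* F) (f : F[X]) : F[X] := (f.map σ).reverse

variable {σ : F →+* F}

theorem conjReverse_pow (f : F[X]) (n : ℕ) : conjReverse σ (f ^ n) = conjReverse σ f ^ n := by
  induction n with
  | zero => rw [pow_zero, pow_zero, conjReverse, Polynomial.map_one, ← C_1, reverse_C]
  | succ n ih =>
    rw [pow_succ, pow_succ, ← ih, conjReverse, Polynomial.map_mul, reverse_mul_of_domain]
    rfl

theorem conjReverse_conjReverse (hσ : ∀ c, σ (σ c) = c) {f : F[X]} (h0 : f.coeff 0 ≠ 0) :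
    conjReverse σ (conjReverse σ f) = f := by
  have h1 : (f.map σ).reverse.map σ = f.reverse := by
    have h2 : σ.comp σ = RingHom.id F := RingHom.ext hσ
    rw [reverse, ← reflect_map, Polynomial.map_map, h2, Polynomial.map_id, natDegree_map, reverse]
  rw [conjReverse, conjReverse, h1, reverse_reverse_of_coeff_zero h0]

theorem irreducible_conjReverse (hσ : ∀ c, σ (σ c) = c) {f : F[X]} (hf : Irreducible f)
    (h0 : f.coeff 0 ≠ 0) : Irreducible (conjReverse σ f) := by
  refine irreducible_reverse ?_ ?_
  · let s : F ≃+* F := RingEquiv.ofBijective σ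
      ⟨σ.injective, fun c => ⟨σ c, hσ c⟩⟩
    exact (MulEquiv.irreducible_iff (Polynomial.mapEquiv s).toMulEquiv).2 hf
  · rw [coeff_map]
    exact (map_ne_zero σ).2 h0

end ConjReverse

/-! ### Lower bound: isometries commuting with `x` -/

section Projections

variable {F V : Type*} [Field F] [Finite F] [AddCommGroup V] [Module F V] [FiniteDimensional F V]
  {σ : F →+* F} {β : V →ₗ[F] V →ₛₗ[σ] F} {x : V ≃ₗ[F] V}

omit [Finite F] [FiniteDimensional F V] in
-- Otherwise `f` is associated to `X`, but `x` is invertible.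
theorem coeff_zero_ne_zero_of_hasBlock {f : F[X]} (hf : Irreducible f) {m : ℕ}
    (h : HasBlock (aeval (x : Module.End F V) f) m) : f.coeff 0 ≠ 0 := by
  intro h0
  have h1 : f ∣ X := (irreducible_X.dvd_symm hf) (X_dvd_iff.2 h0)
  obtain ⟨c, hc⟩ := pow_dvd_pow_of_dvd h1 m
  obtain ⟨v, hv, hv'⟩ := h
  have h2 := congrArg (fun p => aeval (x : Module.End F V) p v) hc
  simp only [mul_comm (f ^ m), aeval_mul_apply, map_pow, aeval_X, hv, map_zero] at h2
  have h3 : ((x : Module.End F V) ^ m) v = (x ^ m) v :=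
    LinearMap.congr_fun (map_pow (LinearEquiv.automorphismGroup.toLinearMapMonoidHom) x m).symm v
  rw [h3, LinearEquiv.map_eq_zero_iff] at h2
  rw [h2, map_zero] at hv'
  exact hv' (Submodule.zero_mem _)

/-- The range of `f(x) ^ m` contains everything orthogonal to the kernel of the `m`-th power of the
conjugate reverse. A block provides `f ^ (m - 1) v` outside this range, so some `w` in that kernel
detects it. -/
theorem exists_dual_pair (hσ : ∀ c, σ (σ c) = c) (hβ : β.SeparatingRight)
    (hx : ∀ u v, β (x u) (x v) = β u v) {f : F[X]} (h0 : f.coeff 0 ≠ 0) {m : ℕ}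
    (h : HasBlock (aeval (x : Module.End F V) f) m) :
    ∃ v w, aeval (x : Module.End F V) (f ^ m) v = 0 ∧
      aeval (x : Module.End F V) (conjReverse σ f ^ m) w = 0 ∧
      β w (aeval (x : Module.End F V) (f ^ (m - 1)) v) ≠ 0 := by
  obtain ⟨v, hv, hv'⟩ := h
  rw [← map_pow] at hv hv'
  rw [← map_pow] at hv'
  by_contra hcon
  push Not at hcon
  apply hv'
  obtain ⟨z, hz⟩ := mem_range_of_orthogonal_ker hβ
    (T := aeval (x : Module.End F V) (conjReverse σ f ^ m))
    (apply_map_aeval (isometry_adjoint hx) hσ _) fun w hw => hcon v w hv hw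
  rw [← hz]
  set D := ((conjReverse σ f ^ m).map σ).natDegree
  refine ⟨((x ^ D)⁻¹ : V ≃ₗ[F] V) z, ?_⟩
  have h1 : ((x : Module.End F V) ^ D) (((x ^ D)⁻¹ : V ≃ₗ[F] V) z) = z := by
    have h3 : ∀ u, ((x : Module.End F V) ^ D) u = (x ^ D) u :=
      LinearMap.congr_fun (map_pow (LinearEquiv.automorphismGroup.toLinearMapMonoidHom) x D).symm
    rw [h3]
    exact (x ^ D).apply_symm_apply z
  have h2 := aeval_map_inverse_mul_pow (σ := σ) (x := x) (conjReverse σ f ^ m)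
  have h4 : ((conjReverse σ f ^ m).map σ).reverse = f ^ m := by
    change conjReverse σ (conjReverse σ f ^ m) = f ^ m
    rw [conjReverse_pow, conjReverse_conjReverse hσ h0]
  rw [h4] at h2
  rw [← h2, Module.End.mul_apply, h1]

theorem projection_fixes (hx : ∀ u v, β (x u) (x v) = β u v) {v w : V}
    (hL : ∀ b ∈ cyc (x : Module.End F V) w,
      (∀ a ∈ cyc (x : Module.End F V) v, β a b = 0) → b = 0) {e : Module.End F V}
    (he : ∀ z, e z ∈ cyc (x : Module.End F V) w)
    (he' : ∀ z, ∀ a ∈ cyc (x : Module.End F V) v, β a (e z) = β a z) :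
    e w = w ∧ Commute e (x : Module.End F V) := by
  have huniq : ∀ b ∈ cyc (x : Module.End F V) w, ∀ b' ∈ cyc (x : Module.End F V) w,
      (∀ a ∈ cyc (x : Module.End F V) v, β a b = β a b') → b = b' := fun b hb b' hb' h =>
    sub_eq_zero.1 (hL _ (Submodule.sub_mem _ hb hb') fun a ha => by rw [map_sub, h a ha, sub_self])
  refine ⟨huniq _ (he w) _ self_mem_cyc (he' w), ?_⟩
  ext z
  have hX : ∀ {b}, b ∈ cyc (x : Module.End F V) w → x b ∈ cyc (x : Module.End F V) w :=
    fun {b} hb => by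
      have := aeval_mem_cyc X hb
      rwa [aeval_X] at this
  refine huniq _ (he _) _ (hX (he z)) fun a ha => ?_
  have hXi : ((x⁻¹ : V ≃ₗ[F] V) a) ∈ cyc (x : Module.End F V) v := by
    have := aeval_inverse_mem_cyc X ha
    rwa [aeval_X] at this
  have hadj : ∀ u, β a (x u) = β ((x⁻¹ : V ≃ₗ[F] V) a) u := fun u => by
    rw [← hx ((x⁻¹ : V ≃ₗ[F] V) a) u]
    exact congrArg (fun b => β b (x u)) (x.apply_symm_apply a).symm
  rw [he' _ a ha]
  change β a (x z) = β a (x (e z))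
  rw [hadj, hadj, he' _ _ hXi]

/-- The projections onto two paired cyclic submodules. -/
theorem exists_adjoint_projections (hs : IsHermitianForm β) (hσ : ∀ c, σ (σ c) = c)
    (hx : ∀ u v, β (x u) (x v) = β u v) {f : F[X]} (hf : Irreducible f)
    (hf' : Irreducible (conjReverse σ f)) {m : ℕ} {v w : V}
    (hv : aeval (x : Module.End F V) (f ^ m) v = 0)
    (hw : aeval (x : Module.End F V) (conjReverse σ f ^ m) w = 0)
    (hvw : β w (aeval (x : Module.End F V) (f ^ (m - 1)) v) ≠ 0) :
    ∃ e e' : Module.End F V, (∀ z, e z ∈ cyc (x : Module.End F V) v) ∧ e v = v ∧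
      Commute e (x : Module.End F V) ∧ (∀ z, e' z ∈ cyc (x : Module.End F V) w) ∧ e' w = w ∧
      Commute e' (x : Module.End F V) ∧ (∀ u z, β (e u) z = β u (e' z)) ∧ (v = w → e = e') := by
  have hvw' : β (aeval (x : Module.End F V) (f ^ (m - 1)) v) w ≠ 0 := by
    rw [hs]
    exact (map_ne_zero σ).2 hvw
  have hK : ∀ a ∈ cyc (x : Module.End F V) v,
      (∀ b ∈ cyc (x : Module.End F V) w, β a b = 0) → a = 0 := fun a ha =>
    eq_zero_of_orthogonal_cyc hσ hx hf hv ⟨w, self_mem_cyc, hvw'⟩ ha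
  have hL' : ∀ b ∈ cyc (x : Module.End F V) w,
      (∀ a ∈ cyc (x : Module.End F V) v, β b a = 0) → b = 0 := fun b hb => by
    refine eq_zero_of_orthogonal_cyc hσ hx hf' hw
      ⟨((x : Module.End F V) ^ ((f ^ (m - 1)).map σ).natDegree) v, ?_, ?_⟩ hb
    · have := aeval_mem_cyc (x := (x : Module.End F V)) (v := v)
        (X ^ ((f ^ (m - 1)).map σ).natDegree) self_mem_cyc
      rwa [map_pow, aeval_X] at this
    · rw [hs, ← conjReverse_pow, conjReverse, ← form_aeval hσ hx]
      exact (map_ne_zero σ).2 hvw'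
  have hL : ∀ b ∈ cyc (x : Module.End F V) w,
      (∀ a ∈ cyc (x : Module.End F V) v, β a b = 0) → b = 0 := fun b hb h =>
    hL' b hb fun a ha => by rw [hs, h a ha, map_zero]
  have hK' : ∀ a ∈ cyc (x : Module.End F V) v,
      (∀ b ∈ cyc (x : Module.End F V) w, β b a = 0) → a = 0 := fun a ha h =>
    hK a ha fun b hb => by rw [hs, h b hb, map_zero]
  obtain ⟨e', he', hee'⟩ := exists_projection hs hK hL
  obtain ⟨e, he, hee⟩ := exists_projection hs hL' hK'
  obtain ⟨h1, h2⟩ := projection_fixes hx hL he' hee'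
  obtain ⟨h3, h4⟩ := projection_fixes hx hK' he hee
  refine ⟨e, e', he, h3, h4, he', h1, h2, fun u z => ?_, ?_⟩
  · rw [← hee' z _ (he u), hs, hee u _ (he' z), ← hs]
  · rintro rfl
    ext z
    refine sub_eq_zero.1 (hL _ (Submodule.sub_mem _ (he z) (he' z)) fun a ha => ?_)
    rw [map_sub, hee z a ha, hee' z a ha, sub_self]

/-- With `p` of norm `l` modulo `f`, the map `B = 1 + (p(x) - 1) e` has determinant `l ^ m` and its
adjoint `B'` commutes with it, since `e` and `e'` commute. Hence `B * B'⁻¹` is an isometry, and `det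
B'` is the conjugate of `l ^ m`. -/
theorem exists_isometry_of_projections (hs : IsHermitianForm β) (hσ : ∀ c, σ (σ c) = c)
    (hβ : β.SeparatingLeft) (hx : ∀ u v, β (x u) (x v) = β u v) {f : F[X]} (hf : Irreducible f)
    {m : ℕ} (hm : 0 < m) {v : V} (hv : aeval (x : Module.End F V) (f ^ m) v = 0)
    (hv' : aeval (x : Module.End F V) (f ^ (m - 1)) v ≠ 0) {e e' : Module.End F V}
    (he : ∀ z, e z ∈ cyc (x : Module.End F V) v) (hev : e v = v)
    (hex : Commute e (x : Module.End F V)) (hex' : Commute e' (x : Module.End F V))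
    (hadj : ∀ u z, β (e u) z = β u (e' z)) (hee : Commute e e') {l : F} (hl : l ≠ 0) :
    ∃ y : V ≃ₗ[F] V, (∀ u v, β (y u) (y v) = β u v) ∧
      Commute (y : Module.End F V) (x : Module.End F V) ∧
      LinearMap.det (y : Module.End F V) * σ (l ^ m) = l ^ m := by
  have : Fact (Irreducible f) := ⟨hf⟩
  have : Module.Finite F (AdjoinRoot f) := (AdjoinRoot.powerBasis hf.ne_zero).finite
  have : Finite (AdjoinRoot f) := Module.finite_of_finite F
  obtain ⟨a, ha⟩ := FiniteField.norm_surjective F (AdjoinRoot f) l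
  obtain ⟨p, rfl⟩ := AdjoinRoot.mk_surjective a
  set xi : Module.End F V := ((x⁻¹ : V ≃ₗ[F] V) : Module.End F V) with hxi
  have hxxi : (x : Module.End F V) * xi = 1 := by ext u; exact x.apply_symm_apply u
  have hxix : xi * (x : Module.End F V) = 1 := by ext u; exact x.symm_apply_apply u
  set P : Module.End F V := aeval (x : Module.End F V) p with hP
  set P' : Module.End F V := aeval xi (p.map σ) with hP'
  set B : Module.End F V := 1 + (P - 1) * e with hB
  set B' : Module.End F V := 1 + (P' - 1) * e' with hB'
  have hcomm : ∀ T : Module.End F V, Commute T (x : Module.End F V) → Commute T P ∧ Commute T P' :=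
    fun T hT => ⟨commute_aeval hT _, commute_aeval (commute_of_inverse hxxi hxix hT) _⟩
  have hPx : Commute P (x : Module.End F V) := (commute_aeval (Commute.refl _) _).symm
  have hPx' : Commute P' (x : Module.End F V) :=
    (commute_aeval (commute_of_inverse hxxi hxix (Commute.refl _)) _).symm
  have hBx : Commute B (x : Module.End F V) :=
    (Commute.one_left _).add_left ((hPx.sub_left (Commute.one_left _)).mul_left hex)
  have hBx' : Commute B' (x : Module.End F V) :=
    (Commute.one_left _).add_left ((hPx'.sub_left (Commute.one_left _)).mul_left hex')
  have hBe' : Commute B e' := (Commute.one_left _).add_left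
    ((((hcomm e' hex').1).symm.sub_left (Commute.one_left _)).mul_left hee)
  have hBB' : Commute B B' := (Commute.one_right _).add_right
    (((hcomm B hBx).2.sub_right (Commute.one_right _)).mul_right hBe')
  have hadjP : ∀ u z, β (P u) z = β u (P' z) := apply_map_aeval (isometry_adjoint hx) hσ p
  have hadjB : ∀ u z, β (B u) z = β u (B' z) := fun u z => by
    have h1 : ∀ t, B t = t + (P (e t) - e t) := fun t => rfl
    have h2 : ∀ t, B' t = t + (e' (P' t) - e' t) := fun t => by
      rw [hB', sub_mul, ← (hcomm e' hex').2.eq, one_mul]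
      rfl
    rw [h1, h2]
    simp only [map_add, map_sub, LinearMap.add_apply, LinearMap.sub_apply, hadjP, hadj]
  have hdetB : LinearMap.det B = l ^ m := by
    rw [hB, hP, det_on_cyclic hm hex he hev hv hv', ha]
  have hdetB' : LinearMap.det B = σ (LinearMap.det B') := det_eq_map_det_of_adjoint hβ hadjB
  have hB'0 : LinearMap.det B' ≠ 0 := by
    intro h0
    rw [h0, map_zero, hdetB] at hdetB'
    exact pow_ne_zero m hl hdetB'
  have hunit : IsUnit B' := by
    rw [LinearMap.isUnit_iff_isUnit_det]
    exact isUnit_iff_ne_zero.2 hB'0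
  obtain ⟨Ci, hC, hC'⟩ := isUnit_iff_exists.1 hunit
  have hadjB' : ∀ u z, β u (B z) = β (B' u) z := fun u z => by
    rw [hs, hadjB, ← hs]
  have hiso : ∀ u z, β ((B * Ci) u) ((B * Ci) z) = β u z := fun u z => by
    have h1 : B' * (B * Ci) = B := by rw [← mul_assoc, ← hBB'.eq, mul_assoc, hC, mul_one]
    have h2 : ∀ t, B' ((B * Ci) t) = B t := fun t => LinearMap.congr_fun h1 t
    have h3 : ∀ t, B' (Ci t) = t := fun t => LinearMap.congr_fun hC t
    have h4 : (B * Ci) u = B (Ci u) := rfl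
    rw [h4, hadjB, h2, hadjB', h3]
  have hinj : Function.Injective (B * Ci) := by
    rw [← LinearMap.ker_eq_bot, LinearMap.ker_eq_bot']
    intro u hu
    refine hβ u fun z => ?_
    rw [← hiso, hu, map_zero, LinearMap.zero_apply]
  have hCx : Commute Ci (x : Module.End F V) := (commute_of_inverse hC hC' hBx'.symm).symm
  refine ⟨LinearEquiv.ofInjectiveEndo (B * Ci) hinj, hiso, hBx.mul_left hCx, ?_⟩
  change LinearMap.det (B * Ci) * _ = _
  have h5 : LinearMap.det B' * LinearMap.det Ci = 1 := by rw [← map_mul, hC, map_one]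
  have h6 : σ (l ^ m) = LinearMap.det B' := by
    rw [← hdetB, hdetB', hσ]
  rw [h6, map_mul, hdetB, mul_assoc, mul_comm (LinearMap.det Ci), h5, mul_one]

omit [Finite F] [FiniteDimensional F V] in
-- Polarization with `v + w` and `v + c • w`: a sesquilinear form with nontrivial `σ` that vanishes
-- on the diagonal is zero.
theorem exists_self_pair {c : F} (hc : σ c ≠ c) {M : Submodule F V} {S : Module.End F V} {v w : V}
    (hv : v ∈ M) (hw : w ∈ M) (h : β w (S v) ≠ 0) : ∃ u ∈ M, β u (S u) ≠ 0 := by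
  by_contra hcon
  push Not at hcon
  have h1 := hcon (v + w) (M.add_mem hv hw)
  have h2 := hcon (v + c • w) (M.add_mem hv (M.smul_mem c hw))
  simp only [map_add, LinearMap.add_apply, map_smul, LinearMap.smul_apply, map_smulₛₗ, hcon v hv,
    hcon w hw, smul_eq_mul] at h1 h2
  have h3 : (σ c - c) * β w (S v) = 0 := by linear_combination σ c * h1 - h2
  exact (mul_ne_zero (sub_ne_zero.2 hc) h) h3

omit [Finite F] in
-- Hilbert 90 for an involution: `l = t + z * σ t` works whenever it is nonzero, and `t = 1` or `t =
-- c` achieves this.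
theorem exists_eq_div_conj (hσ : ∀ c, σ (σ c) = c) {c : F} (hc : σ c ≠ c) {z : F}
    (hz : z * σ z = 1) : ∃ l : F, l ≠ 0 ∧ z * σ l = l := by
  have hex : ∃ t, t + z * σ t ≠ 0 := by
    by_contra hcon
    push Not at hcon
    have h1 := hcon 1
    have h2 := hcon c
    rw [map_one, mul_one] at h1
    exact hc (by linear_combination σ c * h1 - h2)
  obtain ⟨t, ht⟩ := hex
  refine ⟨_, ht, ?_⟩
  rw [map_add, map_mul, hσ]
  linear_combination t * hz

/-- For every elementary divisor `f ^ m` of the unitary transformation `x` and every `z` of norm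
one, the centralizer of `x` contains a unitary transformation of determinant `z ^ m`. -/
theorem exists_commuting_isometry_det (hs : IsHermitianForm β) (hσ : ∀ c, σ (σ c) = c) {c : F}
    (hc : σ c ≠ c) (hβ : β.Nondegenerate) (hx : ∀ u v, β (x u) (x v) = β u v) {f : F[X]}
    (hf : Irreducible f) {m : ℕ} (hm : 0 < m) (h : HasBlock (aeval (x : Module.End F V) f) m)
    {z : F} (hz : z * σ z = 1) :
    ∃ y : V ≃ₗ[F] V, (∀ u v, β (y u) (y v) = β u v) ∧
      Commute (y : Module.End F V) (x : Module.End F V) ∧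
      LinearMap.det (y : Module.End F V) = z ^ m := by
  have h0 := coeff_zero_ne_zero_of_hasBlock hf h
  have hf' := irreducible_conjReverse hσ hf h0
  obtain ⟨l, hl, hzl⟩ := exists_eq_div_conj hσ hc hz
  suffices hmain : ∃ y : V ≃ₗ[F] V, (∀ u v, β (y u) (y v) = β u v) ∧
      Commute (y : Module.End F V) (x : Module.End F V) ∧
      LinearMap.det (y : Module.End F V) * σ (l ^ m) = l ^ m by
    obtain ⟨y, h1, h2, h3⟩ := hmain
    refine ⟨y, h1, h2, mul_right_cancel₀ ((map_ne_zero σ).2 (pow_ne_zero m hl)) ?_⟩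
    rw [h3, map_pow, ← mul_pow, hzl]
  obtain ⟨v, w, hv, hw, hvw⟩ := exists_dual_pair hσ hβ.2 hx h0 h
  -- If `f` is self-dual up to a unit, `v = w` can be arranged and `e = e'`. Otherwise the two
  -- cyclic modules have coprime annihilators, so `e * e' = e' * e = 0`. Either way the projections
  -- commute.
  by_cases hdvd : conjReverse σ f ∣ f
  · have hker : ∀ u, aeval (x : Module.End F V) (f ^ m) u = 0 ↔
        aeval (x : Module.End F V) (conjReverse σ f ^ m) u = 0 := fun u => by
      obtain ⟨s, hs⟩ := pow_dvd_pow_of_dvd hdvd m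
      obtain ⟨t, ht⟩ := pow_dvd_pow_of_dvd (hf'.dvd_symm hf hdvd) m
      constructor
      · intro hu
        rw [ht, mul_comm, aeval_mul_apply, hu, map_zero]
      · intro hu
        rw [hs, mul_comm, aeval_mul_apply, hu, map_zero]
    obtain ⟨u, hu, huu⟩ := exists_self_pair hc
      (M := LinearMap.ker (aeval (x : Module.End F V) (f ^ m))) hv ((hker w).2 hw) hvw
    obtain ⟨e, e', he, hev, hex, -, -, hex', hadj, heq⟩ :=
      exists_adjoint_projections hs hσ hx hf hf' hu ((hker u).1 hu) huu
    refine exists_isometry_of_projections hs hσ hβ.1 hx hf hm hu ?_ he hev hex hex' hadj ?_ hl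
    · exact fun h1 => huu (by rw [h1, map_zero])
    · rw [heq rfl]
  · have hcop : IsCoprime (f ^ m) (conjReverse σ f ^ m) :=
      (IsCoprime.pow (hf'.coprime_iff_not_dvd.2 hdvd)).symm
    obtain ⟨e, e', he, hev, hex, he', hev', hex', hadj, -⟩ :=
      exists_adjoint_projections hs hσ hx hf hf' hv hw hvw
    refine exists_isometry_of_projections hs hσ hβ.1 hx hf hm hv ?_ he hev hex hex' hadj ?_ hl
    · exact fun h1 => hvw (by rw [h1, map_zero])
    · have key : ∀ {g h : F[X]} {a b : V} {d d' : Module.End F V}, IsCoprime (g ^ m) (h ^ m) →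
          aeval (x : Module.End F V) (g ^ m) a = 0 → aeval (x : Module.End F V) (h ^ m) b = 0 →
          (∀ z, d z ∈ cyc (x : Module.End F V) a) → Commute d (x : Module.End F V) →
          (∀ z, d' z ∈ cyc (x : Module.End F V) b) → d * d' = 0 := by
        intro g h a b d d' hgh ha hb hd hdx hd'
        have hann : ∀ {g : F[X]} {a t : V}, aeval (x : Module.End F V) (g ^ m) a = 0 →
            t ∈ cyc (x : Module.End F V) a → aeval (x : Module.End F V) (g ^ m) t = 0 := by
          intro g a t ha ht
          obtain ⟨q, rfl⟩ := mem_cyc.1 ht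
          rw [← aeval_mul_apply, mul_comm, aeval_mul_apply, ha, map_zero]
        ext t
        refine eq_zero_of_isCoprime (x := (x : Module.End F V)) hgh (hann ha (hd _)) ?_
        change aeval (x : Module.End F V) (h ^ m) (d (d' t)) = 0
        rw [← apply_comm (commute_aeval hdx (h ^ m)), hann hb (hd' t), map_zero]
      change e * e' = e' * e
      rw [key hcop hv hw he hex he', key hcop.symm hw hv he' hex' he]

/-- If `(X - ε) ^ m` with `ε = ± 1` and `m` odd is an elementary divisor of the orthogonal
transformation `x`, then the centralizer of `x` contains an orthogonal transformation of
determinant `-1`. -/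
theorem exists_commuting_isometry_det_neg_one {β : V →ₗ[F] V →ₗ[F] F} (h2 : (2 : F) ≠ 0)
    (hs : ∀ u v, β u v = β v u) (hβ : β.Nondegenerate) (hx : ∀ u v, β (x u) (x v) = β u v) {ε : F}
    (hε : ε * ε = 1) {m : ℕ} (hm : Odd m)
    (h : HasBlock (aeval (x : Module.End F V) (X - C ε)) m) :
    ∃ y : V ≃ₗ[F] V, (∀ u v, β (y u) (y v) = β u v) ∧
      Commute (y : Module.End F V) (x : Module.End F V) ∧
      LinearMap.det (y : Module.End F V) = -1 := by
  have hf : Irreducible (X - C ε) := irreducible_X_sub_C ε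
  have h0 := coeff_zero_ne_zero_of_hasBlock hf h
  have hσ : ∀ c : F, RingHom.id F (RingHom.id F c) = c := fun c => rfl
  have hf' := irreducible_conjReverse (σ := RingHom.id F) hσ hf h0
  have hcr : conjReverse (RingHom.id F) (X - C ε) = C (-ε) * (X - C ε) := by
    have h1 : (X - C ε : F[X]) = X + C (-ε) := by rw [map_neg, sub_eq_add_neg]
    have h3 : (C ε * C ε : F[X]) = 1 := by rw [← C_mul, hε, C_1]
    rw [conjReverse, Polynomial.map_id, h1, reverse_add_C]
    simp only [natDegree_X, pow_one, map_neg]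
    have h4 : (X : F[X]).reverse = 1 := by
      rw [← pow_one (X : F[X]), ← one_mul ((X : F[X]) ^ 1), reverse_mul_X_pow, ← C_1, reverse_C]
    linear_combination h4 - h3
  have hCC : (C (-ε) * C (-ε) : F[X]) = 1 := by rw [← C_mul, neg_mul_neg, hε, C_1]
  have hfcr : X - C ε = C (-ε) * conjReverse (RingHom.id F) (X - C ε) := by
    rw [hcr, ← mul_assoc, hCC, one_mul]
  have hker : ∀ u, aeval (x : Module.End F V) ((X - C ε) ^ m) u = 0 ↔
      aeval (x : Module.End F V) (conjReverse (RingHom.id F) (X - C ε) ^ m) u = 0 := fun u => by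
    constructor
    · intro hu
      rw [hcr, mul_pow, aeval_mul_apply, hu, map_zero]
    · intro hu
      rw [hfcr, mul_pow, aeval_mul_apply, hu, map_zero]
  obtain ⟨v, w, hv, hw, hvw⟩ := exists_dual_pair (σ := RingHom.id F) hσ hβ.2 hx h0 h
  rw [← hker] at hw
  obtain ⟨j, rfl⟩ := hm
  rw [Nat.add_sub_cancel] at hvw
  set S : Module.End F V := aeval (x : Module.End F V) ((X - C ε) ^ (2 * j)) with hS
  -- As `2 * j` is even, the adjoint of `S` is `S` up to the power `x ^ (2 * j)`, which fixes the
  -- eigenvector `S w` since `ε ^ 2 = 1`. So `β u (S v)` is symmetric on the kernel, and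
  -- polarization in odd characteristic gives a vector paired with itself.
  have hsymm : β w (S v) = β v (S w) := by
    have h3 : ∀ (n : ℕ) (u : V), ((x : Module.End F V) ^ n) u = (x ^ n) u := fun n =>
      LinearMap.congr_fun (map_pow (LinearEquiv.automorphismGroup.toLinearMapMonoidHom) x n).symm
    have h4 : x (S w) = ε • S w := by
      rw [pow_succ', aeval_mul_apply, ← hS, map_sub, aeval_X, aeval_C, LinearMap.sub_apply,
        Module.algebraMap_end_apply, sub_eq_zero] at hw
      exact hw
    have h5 : ((x : Module.End F V) ^ (2 * j)) (S w) = S w := by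
      have h6 : ∀ i : ℕ, ((x : Module.End F V) ^ (2 * i)) (S w) = S w := fun i => by
        induction i with
        | zero => rfl
        | succ i ih =>
          rw [mul_add, mul_one, pow_add, Module.End.mul_apply, sq, Module.End.mul_apply]
          change ((x : Module.End F V) ^ (2 * i)) (x (x (S w))) = S w
          rw [h4, map_smul, h4, smul_smul, hε, one_smul, ih]
      exact h6 j
    have h7 : ((X - C ε) ^ (2 * j) |>.map (RingHom.id F)).natDegree = 2 * j := by
      rw [Polynomial.map_id, natDegree_pow, natDegree_X_sub_C, mul_one]
    have h8 : conjReverse (RingHom.id F) ((X - C ε) ^ (2 * j)) = (X - C ε) ^ (2 * j) := by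
      rw [conjReverse_pow, hcr, mul_pow, pow_mul (C (-ε)), sq (C (-ε)), hCC, one_pow, one_mul]
    have h9 := form_aeval (σ := RingHom.id F) hσ hx ((X - C ε) ^ (2 * j)) v w
    change _ = β _ (aeval (x : Module.End F V) (conjReverse (RingHom.id F) _) w) at h9
    rw [h8, h7, ← hS, ← h5, h3, h3, isometry_pow hx] at h9
    rw [hs, h9]
  obtain ⟨u, hu, huu⟩ : ∃ u, aeval (x : Module.End F V) ((X - C ε) ^ (2 * j + 1)) u = 0 ∧
      β u (S u) ≠ 0 := by
    by_contra hcon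
    push Not at hcon
    have h3 := hcon (v + w) (by rw [map_add, hv, hw, add_zero])
    simp only [map_add, LinearMap.add_apply, hcon v hv, hcon w hw] at h3
    have h4 : 2 * β w (S v) = 0 := by linear_combination h3 + hsymm
    exact (mul_ne_zero h2 hvw) h4
  obtain ⟨e, e', he, hev, hex, -, -, -, hadj, heq⟩ :=
    exists_adjoint_projections (σ := RingHom.id F) (fun u v => hs u v) hσ hx hf hf' hu
      ((hker u).1 hu) (by rwa [Nat.add_sub_cancel])
  obtain rfl := heq rfl
  have : Fact (Irreducible (X - C ε)) := ⟨hf⟩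
  -- The constant polynomial `-1` makes `B = 1 - 2e`, a self-adjoint involution and hence an
  -- isometry, which negates a cyclic module of odd dimension `2 * j + 1`.
  have hdet := det_on_cyclic (m := 2 * j + 1) (Nat.succ_pos _) hex he hev hu
    (by
      rw [Nat.add_sub_cancel]
      exact fun h1 => huu (by rw [hS, h1, map_zero])) (-1)
  rw [map_neg, map_one, map_neg, map_one] at hdet
  set B : Module.End F V := 1 + (-1 - 1) * e with hB
  have hBe : ∀ z, B z = z + (-(e z) - e z) := fun z => rfl
  have hadjB : ∀ a b, β (B a) b = β a (B b) := fun a b => by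
    rw [hBe, hBe]
    simp only [map_add, map_sub, map_neg, LinearMap.add_apply, LinearMap.sub_apply,
      LinearMap.neg_apply, hadj]
  have hecyc : ∀ z, e (e z) = e z := fun z => by
    obtain ⟨q, hq⟩ := mem_cyc.1 (he z)
    rw [← hq, apply_comm (commute_aeval hex q), hev]
  have hBB : ∀ z, B (B z) = z := fun z => by
    rw [hBe (B z), hBe z]
    simp only [map_add, map_sub, map_neg, hecyc]
    abel
  refine ⟨LinearEquiv.ofInjectiveEndo B (Function.LeftInverse.injective hBB), fun a b => ?_, ?_, ?_⟩
  · change β (B a) (B b) = β a b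
    rw [hadjB, hBB]
  · change Commute B (x : Module.End F V)
    exact (Commute.one_left _).add_left
      ((((Commute.one_left _).neg_left).sub_left (Commute.one_left _)).mul_left hex)
  · change LinearMap.det B = -1
    have h3 : (-1 : AdjoinRoot (X - C ε)) = algebraMap F _ (-1) := by rw [map_neg, map_one]
    rw [hdet, h3, Algebra.norm_algebraMap, (AdjoinRoot.powerBasis hf.ne_zero).finrank,
      AdjoinRoot.powerBasis_dim, natDegree_X_sub_C, pow_one, Odd.neg_one_pow ⟨j, rfl⟩]

end Projections

/-! ### The two splitting theorems -/

section Main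

variable {F V : Type*} [Field F] [AddCommGroup V] [Module F V]

/-- Applied with `x = 1`, the constructions of commuting isometries show which determinants the
whole group attains. -/
theorem hasBlock_one [Nontrivial V] :
    HasBlock (aeval ((1 : V ≃ₗ[F] V) : Module.End F V) (X - C (1 : F))) 1 := by
  have h0 : aeval ((1 : V ≃ₗ[F] V) : Module.End F V) (X - C (1 : F)) = 0 := by
    rw [map_sub, aeval_X, aeval_C, map_one]
    exact sub_self _
  obtain ⟨v, hv⟩ := exists_ne (0 : V)
  rw [h0]
  refine ⟨v, by simp, ?_⟩
  rintro ⟨w, hw⟩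
  apply hv
  simpa using hw.symm

theorem ncard_classesInside_special (G : Subgroup (V ≃ₗ[F] V)) (x : special G) :
    (classesInside _ x).ncard = ((Subgroup.centralizer {(x : G)}).map
      (LinearEquiv.det.comp G.subtype)).relIndex (LinearEquiv.det.comp G.subtype).range :=
  ncard_classesInside_ker _ x

theorem mem_map_centralizer {G : Subgroup (V ≃ₗ[F] V)} {x : G} {z : Fˣ} :
    z ∈ (Subgroup.centralizer {x}).map (LinearEquiv.det.comp G.subtype) ↔
      ∃ y ∈ G, Commute ((y : V ≃ₗ[F] V) : Module.End F V) ((x : V ≃ₗ[F] V) : Module.End F V) ∧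
        LinearMap.det ((y : V ≃ₗ[F] V) : Module.End F V) = z := by
  constructor
  · rintro ⟨y, hy, rfl⟩
    rw [SetLike.mem_coe, Subgroup.mem_centralizer_singleton_iff] at hy
    refine ⟨y, y.2, ?_, (LinearEquiv.coe_det _).symm⟩
    ext v
    exact congrArg (fun g : G => (g : V ≃ₗ[F] V) v) hy
  · rintro ⟨y, hy, hc, hd⟩
    refine ⟨⟨y, hy⟩, ?_, Units.ext ((LinearEquiv.coe_det y).trans hd)⟩
    rw [SetLike.mem_coe, Subgroup.mem_centralizer_singleton_iff]
    refine Subtype.ext (LinearEquiv.ext fun v => ?_)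
    exact LinearMap.congr_fun hc v

theorem mem_range_det {G : Subgroup (V ≃ₗ[F] V)} {z : Fˣ} :
    z ∈ (LinearEquiv.det.comp G.subtype).range ↔
      ∃ y ∈ G, LinearMap.det ((y : V ≃ₗ[F] V) : Module.End F V) = z := by
  constructor
  · rintro ⟨y, rfl⟩
    exact ⟨y, y.2, (LinearEquiv.coe_det _).symm⟩
  · rintro ⟨y, hy, hd⟩
    exact ⟨⟨y, hy⟩, Units.ext ((LinearEquiv.coe_det y).trans hd)⟩

theorem two_ne_zero_of_odd_card [Finite F] (h : Odd (Nat.card F)) : (2 : F) ≠ 0 := by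
  have := Fintype.ofFinite F
  refine Ring.two_ne_zero fun h2 => ?_
  rw [FiniteField.even_card_iff_char_two, ← Nat.card_eq_fintype_card] at h2
  rw [Nat.odd_iff] at h
  omega

theorem mem_orthogonalGroup_iff (h2 : (2 : F) ≠ 0) {Q : QuadraticForm F V} {g : V ≃ₗ[F] V} :
    g ∈ orthogonalGroup Q ↔ ∀ u v, Q.polarBilin (g u) (g v) = Q.polarBilin u v := by
  constructor
  · intro h u v
    have h' : ∀ v, Q (g v) = Q v := h
    rw [QuadraticMap.polarBilin_apply_apply, QuadraticMap.polarBilin_apply_apply,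
      QuadraticMap.polar, QuadraticMap.polar, ← map_add, h', h', h']
  · intro h v
    have h1 := h v v
    rw [QuadraticMap.polarBilin_apply_apply, QuadraticMap.polarBilin_apply_apply,
      QuadraticMap.polar_self, QuadraticMap.polar_self, two_smul, two_smul, ← two_mul,
      ← two_mul] at h1
    exact mul_left_cancel₀ h2 h1

variable [Finite F] [FiniteDimensional F V] [Nontrivial V]

theorem ncard_classesInside_orthogonal_eq_two_iff (Q : QuadraticForm F V)
    (hodd : Odd (Nat.card F)) (hQ : IsNonsingular Q) (x : special (orthogonalGroup Q)) :
    (classesInside _ x).ncard = 2 ↔ ∀ m : ℕ, Odd m →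
      ¬ IsElementaryDivisor ((x : V ≃ₗ[F] V) : V →ₗ[F] V) (X - 1) m ∧
      ¬ IsElementaryDivisor ((x : V ≃ₗ[F] V) : V →ₗ[F] V) (X + 1) m := by
  have h2 := two_ne_zero_of_odd_card hodd
  set β : V →ₗ[F] V →ₗ[F] F := Q.polarBilin with hβdef
  have hβ : β.Nondegenerate := hQ
  have hs : ∀ u v, β u v = β v u := fun u v => QuadraticMap.polar_comm Q u v
  have hG : ∀ g : V ≃ₗ[F] V, g ∈ orthogonalGroup Q ↔ ∀ u v, β (g u) (g v) = β u v :=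
    fun g => mem_orthogonalGroup_iff h2
  have hx := (hG _).1 (x : orthogonalGroup Q).2
  rw [ncard_classesInside_special]
  set χ := LinearEquiv.det.comp (orthogonalGroup Q).subtype
  have hrange : χ.range = Subgroup.zpowers (-1 : Fˣ) := by
    apply le_antisymm
    · intro z hz
      obtain ⟨y, hy, hd⟩ := mem_range_det.1 hz
      have h3 := det_mul_map_det_of_isometry (σ := RingHom.id F) hβ.1 (A := (y : Module.End F V))
        ((hG y).1 hy)
      rw [RingHom.id_apply, hd, mul_self_eq_one_iff] at h3
      rcases h3 with h3 | h3
      · rw [Units.val_eq_one] at h3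
        rw [h3]
        exact one_mem _
      · have h4 : z = -1 := Units.ext h3
        exact h4 ▸ Subgroup.mem_zpowers _
    · rw [Subgroup.zpowers_le, mem_range_det]
      obtain ⟨y, hy, -, hd⟩ := exists_commuting_isometry_det_neg_one h2 hs hβ (x := 1)
        (fun u v => rfl) (mul_one 1) odd_one hasBlock_one
      exact ⟨y, (hG y).2 hy, by rw [hd]; rfl⟩
  have hcard : Nat.card χ.range = 2 := by
    rw [hrange, Nat.card_zpowers]
    refine orderOf_eq_prime (by simp) fun h3 => h2 ?_
    have h4 : (-1 : F) = 1 := congrArg Units.val h3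
    linear_combination -h4
  constructor
  · intro hindex m hm
    by_contra hcon
    have hε : ∃ ε : F, ε * ε = 1 ∧
        HasBlock (aeval ((x : V ≃ₗ[F] V) : Module.End F V) (X - C ε)) m := by
      rw [not_and_or, not_not, not_not] at hcon
      rcases hcon with h3 | h3
      · exact ⟨1, mul_one 1, by rw [C_1]; exact h3.hasBlock.2.2.2⟩
      · refine ⟨-1, by ring, ?_⟩
        rw [C_neg, C_1, sub_neg_eq_add]
        exact h3.hasBlock.2.2.2
    obtain ⟨ε, hε, hblock⟩ := hε
    obtain ⟨y, hy, hc, hd⟩ := exists_commuting_isometry_det_neg_one h2 hs hβ hx hε hm hblock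
    -- A commuting isometry of determinant `-1` makes the centralizer attain all of `± 1`, so the
    -- index is `1` and the class does not split.
    have hle : χ.range ≤ (Subgroup.centralizer {(x : orthogonalGroup Q)}).map χ := by
      rw [hrange, Subgroup.zpowers_le]
      exact mem_map_centralizer.2 ⟨y, (hG y).2 hy, hc, by rw [hd]; rfl⟩
    rw [Subgroup.relIndex_eq_one.2 hle] at hindex
    omega
  · intro hd
    have hbot : (Subgroup.centralizer {(x : orthogonalGroup Q)}).map χ = ⊥ := by
      rw [eq_bot_iff]
      intro z hz
      obtain ⟨y, hy, hc, hdet⟩ := mem_map_centralizer.1 hz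
      rw [det_eq_one_of_no_odd_divisor h2 hβ.1 hs hx ((hG y).1 hy) hc hd] at hdet
      exact Units.ext hdet.symm
    rw [hbot, Subgroup.relIndex_bot_left, hcard]

theorem ncard_classesInside_unitary {q : ℕ} {σ : F →+* F} (hq : Nat.card F = q ^ 2)
    (hσq : ∀ a, σ a = a ^ q) {β : V →ₗ[F] V →ₛₗ[σ] F} (hs : IsHermitianForm β)
    (hβ : β.Nondegenerate) (x : special (unitaryGroup β)) {k : ℕ} {f : Fin k → F[X]}
    {m : Fin k → ℕ}
    (hfm : ∀ (g : F[X]) (e : ℕ),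
      IsGeneralizedElementaryDivisor σ ((x : V ≃ₗ[F] V) : V →ₗ[F] V) g e ↔
        ∃ i, f i = g ∧ m i = e) :
    (classesInside _ x).ncard = Nat.gcd (Finset.univ.gcd m) (q + 1) := by
  have hFcard : 1 < Nat.card F := Finite.one_lt_card
  have hq2 : 2 ≤ q := by
    by_contra h
    have : q = 0 ∨ q = 1 := by omega
    rcases this with rfl | rfl <;> simp at hq <;> omega
  have hσ : ∀ c, σ (σ c) = c := fun c => by
    have := Fintype.ofFinite F
    rw [hσq, hσq, ← pow_mul, ← sq, ← hq, Nat.card_eq_fintype_card, FiniteField.pow_card]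
  have hunits : Nat.card Fˣ = q ^ 2 - 1 := by rw [Nat.card_units, hq]
  -- A generator of `Fˣ` has order `q ^ 2 - 1 > q - 1`, so it is not fixed by `a ↦ a ^ q`.
  obtain ⟨c, hc⟩ : ∃ c, σ c ≠ c := by
    obtain ⟨g, hg⟩ := IsCyclic.exists_generator (α := Fˣ)
    refine ⟨g, fun h => ?_⟩
    rw [hσq] at h
    have h1 : g ^ (q - 1) = 1 := by
      have h2 : g ^ (q - 1) * g = 1 * g := by
        rw [← pow_succ, one_mul, Nat.sub_add_cancel (by omega)]
        exact Units.ext (by rw [Units.val_pow_eq_pow_val, h])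
      exact mul_right_cancel h2
    have h3 := orderOf_dvd_of_pow_eq_one h1
    rw [orderOf_eq_card_of_forall_mem_zpowers hg, hunits] at h3
    have h4 := Nat.le_of_dvd (by omega) h3
    have h5 : 2 * q ≤ q ^ 2 := by
      rw [sq]
      exact Nat.mul_le_mul_right q hq2
    generalize q ^ 2 = r at h4 h5
    omega
  let M : Subgroup Fˣ := (powMonoidHom (q + 1) : Fˣ →* Fˣ).ker
  have hM : ∀ z : Fˣ, z ∈ M ↔ (z : F) * σ z = 1 := fun z => by
    rw [MonoidHom.mem_ker, powMonoidHom_apply, hσq, ← pow_succ', ← Units.val_pow_eq_pow_val,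
      Units.val_eq_one]
  have hMcard : Nat.card M = q + 1 := by
    rw [IsCyclic.card_powMonoidHom_ker, hunits]
    refine Nat.gcd_eq_right ⟨q - 1, ?_⟩
    rw [← Nat.sq_sub_sq, one_pow]
  have hx : ∀ u v, β ((x : V ≃ₗ[F] V) u) ((x : V ≃ₗ[F] V) v) = β u v := (x : unitaryGroup β).2
  rw [ncard_classesInside_special]
  set χ := LinearEquiv.det.comp (unitaryGroup β).subtype
  set d := Finset.univ.gcd m with hd
  have hrange : χ.range = M := by
    ext z
    rw [mem_range_det, hM]
    constructor
    · rintro ⟨y, hy, hdet⟩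
      rw [← hdet]
      exact det_mul_map_det_of_isometry hβ.1 hy
    · intro hz
      obtain ⟨y, hy, -, hdet⟩ := exists_commuting_isometry_det hs hσ hc hβ (x := 1)
        (fun u v => rfl) (irreducible_X_sub_C 1) one_pos hasBlock_one hz
      exact ⟨y, hy, by rw [hdet, pow_one]⟩
  have hdvd : ∀ g e, IsElementaryDivisor ((x : V ≃ₗ[F] V) : Module.End F V) g e → d ∣ e := by
    intro g e hge
    obtain ⟨hmon, hirr, -, hblock⟩ := hge.hasBlock
    have h0 := coeff_zero_ne_zero_of_hasBlock hirr hblock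
    have hex : ∃ p, IsGeneralizedElementaryDivisor σ ((x : V ≃ₗ[F] V) : V →ₗ[F] V) p e := by
      by_cases hself : dualPoly σ g = g
      · refine ⟨g, Or.inl ⟨?_, hge⟩⟩
        rcases Nat.eq_or_lt_of_le (Nat.succ_le_of_lt hirr.natDegree_pos) with h1 | h1
        · exact Or.inl ⟨hmon, hirr, h0, hself, h1.symm⟩
        · exact Or.inr ⟨hmon, hirr, h0, hself, h1⟩
      · exact ⟨_, Or.inr ⟨g, ⟨hmon, hirr, h0, hself⟩, rfl, hge⟩⟩
    obtain ⟨p, hp⟩ := hex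
    obtain ⟨i, -, rfl⟩ := (hfm p e).1 hp
    exact Finset.gcd_dvd (Finset.mem_univ i)
  -- Since `V ≠ 0` there is an elementary divisor, so the gcd is not the value `0` of the empty
  -- family.
  have hd0 : 0 < d := by
    obtain ⟨g, e, hge⟩ := exists_isElementaryDivisor ((x : V ≃ₗ[F] V) : Module.End F V)
    exact Nat.pos_of_dvd_of_pos (hdvd g e hge) hge.hasBlock.2.2.1
  have hmap : (Subgroup.centralizer {(x : unitaryGroup β)}).map χ = M.map (powMonoidHom d) := by
    apply le_antisymm
    · intro z hz
      obtain ⟨y, hy, hyx, hdet⟩ := mem_map_centralizer.1 hz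
      obtain ⟨t, ht, htd⟩ := exists_det_eq_pow hβ.1 hx hy hyx hd0 hdvd
      have ht0 : t ≠ 0 := left_ne_zero_of_mul_eq_one ht
      refine ⟨Units.mk0 t ht0, (hM _).2 ht, Units.ext ?_⟩
      rw [← hdet, htd]
      rfl
    · rintro _ ⟨z, hz, rfl⟩
      -- Every `z ^ m i` is a determinant on the centralizer; by Bézout so is `z ^ d`.
      refine pow_finset_gcd_mem _ fun i _ => ?_
      have hex : ∃ g, IsElementaryDivisor ((x : V ≃ₗ[F] V) : Module.End F V) g (m i) := by
        rcases (hfm (f i) (m i)).2 ⟨i, rfl, rfl⟩ with ⟨-, h⟩ | ⟨g, -, -, h⟩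
        · exact ⟨_, h⟩
        · exact ⟨_, h⟩
      obtain ⟨g, hg⟩ := hex
      obtain ⟨-, hirr, hpos, hblock⟩ := hg.hasBlock
      obtain ⟨y, hy, hyx, hdet⟩ :=
        exists_commuting_isometry_det hs hσ hc hβ hx hirr hpos hblock ((hM z).1 hz)
      exact mem_map_centralizer.2 ⟨y, hy, hyx, by rw [hdet]; rfl⟩
  have hsub : (M.map (powMonoidHom d)).subgroupOf M = (powMonoidHom d : M →* M).range := by
    ext z
    constructor
    · rintro ⟨t, ht, htz⟩
      exact ⟨⟨t, ht⟩, Subtype.ext htz⟩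
    · rintro ⟨t, rfl⟩
      exact ⟨t, t.2, rfl⟩
  rw [hmap, hrange, Subgroup.relIndex, hsub, IsCyclic.index_powMonoidHom_range, hMcard,
    Nat.gcd_comm]

end Main

end ClassicalGroup

theorem mainTheorem12 {F : Type*} [Field F] [Finite F] {V : Type*} [AddCommGroup V] [Module F V]
    [FiniteDimensional F V] [Nontrivial V] :
    -- orthogonal groups over the field `F` with `q` elements, `q` odd
    (∀ Q : QuadraticForm F V, Odd (Nat.card F) → ClassicalGroup.IsNonsingular Q →
      ∀ x : ClassicalGroup.special (ClassicalGroup.orthogonalGroup Q),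
        (ClassicalGroup.classesInside _ x).ncard = 2 ↔
          ∀ m : ℕ, Odd m →
            ¬ ClassicalGroup.IsElementaryDivisor ((x : V ≃ₗ[F] V) : V →ₗ[F] V) (X - 1) m ∧
            ¬ ClassicalGroup.IsElementaryDivisor ((x : V ≃ₗ[F] V) : V →ₗ[F] V) (X + 1) m) ∧
    -- unitary groups over the field `F` with `q ^ 2` elements, `σ a = a ^ q`
    (∀ (q : ℕ) (σ : F →+* F), Nat.card F = q ^ 2 → (∀ a, σ a = a ^ q) →
      ∀ β : V →ₗ[F] V →ₛₗ[σ] F, ClassicalGroup.IsHermitianForm β → β.Nondegenerate →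
      ∀ x : ClassicalGroup.special (ClassicalGroup.unitaryGroup β),
      ∀ (k : ℕ) (f : Fin k → F[X]) (m : Fin k → ℕ),
        -- `f₁^{m₁}, …, f_k^{m_k}` are the generalized elementary divisors of `x`
        (∀ (g : F[X]) (e : ℕ),
          ClassicalGroup.IsGeneralizedElementaryDivisor σ ((x : V ≃ₗ[F] V) : V →ₗ[F] V) g e ↔
            ∃ i, f i = g ∧ m i = e) →
        (ClassicalGroup.classesInside _ x).ncard = Nat.gcd (Finset.univ.gcd m) (q + 1)) :=
  ⟨ClassicalGroup.ncard_classesInside_orthogonal_eq_two_iff,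
    fun _ _ hq hσ _ hs hβ x _ _ _ hfm =>
      ClassicalGroup.ncard_classesInside_unitary hq hσ hs hβ x hfm⟩
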